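/- **Setting.** Let $N$ be a finite, linearly ordered ground set of size $n$, and let $f:2^N\to\mathbb R$ be monotone and submodular ($f(S\cup T)\le f(S)+f(T)-f(S\cap T)$) with $f(\emptyset)\ge 0$. A *consistent noisy oracle* for $f$ is $\tilde f(S)=\xi_S f(S)$, where the multipliers $(\xi_S)_{S\subseteq N}$ are i.i.d. with law $\mathcal D$, one multiplier per set. The law $\mathcal D$ is a probability measure on $\mathbb R$ that does not depend on $n$ and has a *generalized exponential tail*, that is, one of the following holds: * there is $x_0>0$ such that on $(x_0,\infty)$ the law has density $e^{-g(x)}$ with $g(x)=\sum_i a_i x^{\alpha_i}$ (a finite or convergent sum), where $\alpha_0>\alpha_1\ge\alpha_2\ge\dots$ are real, $\alpha_0\ge 1$ and $a_0>0$; or * $\mathcal D$ has bounded support and either has an atom at the supremum $b$ of the support, or has on some interval $(c,b]$ a density that is (left-)continuous and non-zero at $b$. Moreover, either $\mathcal D$ is supported on $[0,\infty)$ and is not the point mass at $0$, or $\mathcal D$ is Gaussian with positive mean. Logarithms are to base $2$. **Algorithm (Slick-Greedy, budget $k$, accuracy $0<\varepsilon\le 1$).** Let $m=\lceil 6/\varepsilon\rceil$.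 Let $\ell=\lceil 25\log n\rceil$ if $k\ge 2400\log n/\varepsilon^2$, and $\ell=\lceil 33\log\log n\rceil$ otherwise. Take arbitrary pairwise disjoint sets $H_1,\dots,H_m\subseteq N$ of size $\ell$. * *Smooth-Greedy.* For each $j$ let $R_j=\bigcup_{i\ne j}H_i$. Starting from $S=R_j$, perform $k-|R_j|-|H_j|$ times: add to $S$ the element $a\notin S\cup H_j$ (the first one in case of ties) that maximizes the noisy smooth value $2^{-\ell}\sum_{X\subseteq H_j}\tilde f(S\cup X\cup\{a\})$. Let $S_j$ be the resulting set and $T_j=S_j\cup H_j$. * *Smooth-Compare.* To compare $T$ with $U$, take an arbitrary set $C=C(T,U)$ of $\ell$ elements disjoint from $T\cup U$. For every $X\subseteq C$ the set $T$ wins the comparison at $X$ if $\tilde f(T\cup X)\ge\tilde f(U\cup X)$, and $U$ wins it if $\tilde f(U\cup X)\ge\tilde f(T\cup X)$ (both win if the values are equal). Return the set with more wins; equal numbers of wins are resolved lexicographically. * *Tournament.* Start with $T_1$ as current winner, and compare the current winner with $T_2,\dots,T_m$ in turn. Return the final winner $T$. The algorithm is deterministic given the oracle, and it needs the comparison sets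 to exist. We say that *there is room* if $|N\setminus(T_i\cup T_j)|\ge\ell$ for all $i,j$ with $T_i\neq T_j$. **Theorem (Slick-Greedy).** For every fixed $\varepsilon\in(0,1]$ and every law $\mathcal D$ as above there is $n_0$ such that the following holds for all $n\ge n_0$, all $k\ge 3168\,\log\log n/\varepsilon^2$, all $f$ as above, all choices of the sets $H_j$ and of the rule $C$. With probability at least $1-1/n$ over the noise, if there is room, then the set $T$ returned by Slick-Greedy satisfies $|T|\le k$ and $$f(T)\ \ge\ \Bigl(1-\frac1e-\varepsilon\Bigr)\max_{|S|\le k}f(S).$$ Moreover, if $2k\le n$, then there is always room, whatever the noise is. -/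

import Mathlib

open Finset MeasureTheory ProbabilityTheory
open scoped NNReal ENNReal

noncomputable section

namespace NoisySubmodular

/-- A set function is submodular if `f (S ∪ T) ≤ f S + f T - f (S ∩ T)` for all `S`, `T`. -/
def IsSubmodular {N : Type*} [DecidableEq N] (f : Finset N → ℝ) : Prop :=
  ∀ S T : Finset N, f (S ∪ T) ≤ f S + f T - f (S ∩ T)

/-- The optimal value `max_{|S| ≤ k} f S`. -/
def optValue {N : Type*} [Fintype N] (f : Finset N → ℝ) (k : ℕ) : ℝ :=
  (univ.filter (fun S : Finset N => #S ≤ k)).sup' ⟨∅, by simp⟩ f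

/-! ### Noise -/

/-- The upper tail of `D` has a density `exp (-g x)` on some half line, where
`g x = ∑ i, a i * x ^ α i` with non-increasing real exponents, leading exponent at least `1`.
Like powers are merged (`α 1 < α 0`), so that `a 0` really is the leading coefficient; it is
positive.  A finite sum is the case in which `a` is eventually zero. -/
def HasExponentialUpperTail (D : Measure ℝ) : Prop :=
  ∃ (x₀ : ℝ) (a α : ℕ → ℝ) (g : ℝ → ℝ),
    0 < x₀ ∧ Antitone α ∧ 1 ≤ α 0 ∧ α 1 < α 0 ∧ 0 < a 0 ∧
    (∀ x, x₀ < x → HasSum (fun i => a i * x ^ α i) (g x)) ∧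
    D.restrict (Set.Ioi x₀) =
      (volume.restrict (Set.Ioi x₀)).withDensity (fun x => ENNReal.ofReal (Real.exp (-g x)))

/-- `D` has bounded support, and at the supremum `b` of the support it either has an atom or has
(to the left of `b`) a density that is continuous and non-zero at `b`. -/
def HasBoundedTail (D : Measure ℝ) : Prop :=
  ∃ a b : ℝ, D (Set.Icc a b)ᶜ = 0 ∧
    (0 < D {b} ∨
      ∃ (c : ℝ) (p : ℝ → ℝ), c < b ∧ Measurable p ∧
        D.restrict (Set.Ioc c b) =
          (volume.restrict (Set.Ioc c b)).withDensity (fun x => ENNReal.ofReal (p x)) ∧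
        ContinuousWithinAt p (Set.Iic b) b ∧ 0 < p b)

/-- Generalized exponential tail distributions. -/
def HasGeneralizedExponentialTail (D : Measure ℝ) : Prop :=
  HasExponentialUpperTail D ∨ HasBoundedTail D

/-- Distributions of noise multipliers: non-negative and not identically zero, or Gaussian with
positive mean. -/
def IsMultiplierLaw (D : Measure ℝ) : Prop :=
  ((∀ᵐ x ∂D, 0 ≤ x) ∧ ¬ (∀ᵐ x ∂D, x = 0)) ∨
    ∃ (m : ℝ) (v : ℝ≥0), 0 < m ∧ D = gaussianReal m v

/-- The consistent noisy oracle: one multiplier `ξ S` for every set `S`. -/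
def noisyOracle {N : Type*} (f : Finset N → ℝ) (ξ : Finset N → ℝ) : Finset N → ℝ :=
  fun S => ξ S * f S

/-- The joint law of the multipliers: independent for different sets, each with law `D`. -/
def noiseLaw (N : Type*) [Fintype N] (D : Measure ℝ) : Measure (Finset N → ℝ) :=
  Measure.pi (fun _ : Finset N => D)

/-! ### The algorithm

In this part `q : Finset N → ℝ` is the oracle that the algorithm queries. -/

section Algorithm

variable {N : Type*} [Fintype N] [LinearOrder N]

/-- The (noisy) smooth value of `S ∪ {a}` for the smoothing set `H`: the average of
`q (S ∪ (X ∪ {a}))` over all `X ⊆ H`. -/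
def smoothValue (q : Finset N → ℝ) (H S : Finset N) (a : N) : ℝ :=
  (1 / 2 ^ #H) * ∑ X ∈ H.powerset, q (S ∪ (X ∪ {a}))

/-- The elements outside `H ∪ S` of largest smooth value. -/
def argmaxSet (q : Finset N → ℝ) (H S : Finset N) : Finset N :=
  (H ∪ S)ᶜ.filter (fun a => ∀ b ∈ (H ∪ S)ᶜ, smoothValue q H S b ≤ smoothValue q H S a)

/-- One iteration of Smooth-Greedy: add an element of largest smooth value, the first such
element if there are several (and nothing if no element is left). -/
def greedyStep (q : Finset N → ℝ) (H S : Finset N) : Finset N :=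
  if h : (argmaxSet q H S).Nonempty then insert ((argmaxSet q H S).min' h) S else S

/-- Smooth-Greedy with budget `k`, initialized with `R`, with smoothing set `H`: starting from
`S = R` it adds `k - |R| - |H|` elements. -/
def smoothGreedy (q : Finset N → ℝ) (k : ℕ) (R H : Finset N) : Finset N :=
  (greedyStep q H)^[k - #R - #H] R

/-- The number of `X ⊆ C` for which `q (T ∪ X) ≥ q (U ∪ X)`. -/
def wins (q : Finset N → ℝ) (T U C : Finset N) : ℕ :=
  #(C.powerset.filter (fun X => q (U ∪ X) ≤ q (T ∪ X)))

/-- Smooth-Compare: return whichever of `T`, `U` wins more of the comparisons of `q (T ∪ X)` with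
`q (U ∪ X)`, `X ⊆ C` (a comparison with equal values counts for both); equal numbers of wins are
resolved by the lexicographic order of the sorted sets. -/
def smoothCompare (q : Finset N → ℝ) (T U C : Finset N) : Finset N :=
  if wins q U T C < wins q T U C ∨
      (wins q T U C = wins q U T C ∧ T.sort (· ≤ ·) ≤ U.sort (· ≤ ·))
  then T else U

/-- The candidate `T_j = Smooth-Greedy (k, R_j, H_j) ∪ H_j`, where `R_j` is the union of the
`H_i` with `i ≠ j`. -/
def candidate (q : Finset N → ℝ) (k : ℕ) {m : ℕ} (H : Fin m → Finset N) (j : Fin m) : Finset N :=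
  smoothGreedy q k ((univ.erase j).biUnion H) (H j) ∪ H j

/-- The tournament: the current winner `T` meets the remaining sets one after the other; the
comparison of `T` with `U` uses the comparison set `C T U`. -/
def tournament (q : Finset N → ℝ) (C : Finset N → Finset N → Finset N) :
    Finset N → List (Finset N) → Finset N
  | T, [] => T
  | T, U :: L => tournament q C (smoothCompare q T U (C T U)) L

/-- Slick-Greedy with budget `k`, smoothing sets `H 0, …, H (m - 1)` and comparison sets given by
the rule `C`: the winner of the tournament of the candidates. -/
def slickGreedy (q : Finset N → ℝ) (k : ℕ) {m : ℕ} (H : Fin m → Finset N)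
    (C : Finset N → Finset N → Finset N) : Finset N :=
  match List.ofFn (candidate q k H) with
  | [] => ∅
  | T :: L => tournament q C T L

/-- Any two different candidates leave at least `l` elements of the ground set uncovered, so that
the comparison sets of size `l` that the algorithm asks for exist. -/
def HasComparisonRoom (q : Finset N → ℝ) (k l : ℕ) {m : ℕ} (H : Fin m → Finset N) : Prop :=
  ∀ i j : Fin m, candidate q k H i ≠ candidate q k H j →
    l ≤ #(candidate q k H i ∪ candidate q k H j)ᶜ

end Algorithm

/-- The number `1 / δ` of smoothing sets, with `δ = ε / 6`, rounded up. -/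
def numSets (ε : ℝ) : ℕ := ⌈6 / ε⌉₊

/-- The size `ℓ` of the smoothing sets (rounded up): `25 log n` if `k ≥ 2400 log n / ε ^ 2`, and
`33 log log n` otherwise; logarithms are to base `2`. -/
def smoothingSize (ε : ℝ) (n k : ℕ) : ℕ :=
  if 2400 * Real.logb 2 n / ε ^ 2 ≤ k then ⌈25 * Real.logb 2 n⌉₊
  else ⌈33 * Real.logb 2 (Real.logb 2 n)⌉₊

end NoisySubmodular

end

/-! For a smoothing set H let F(S) be the average of f(S ∪ X) over X ⊆ H (`smoothAvg`). It is
monotone and submodular, and f(S) ≤ F(S) ≤ f(S ∪ H). Its noisy version averages 2^ℓ independent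
multipliers of mean μ > 0 with an exponential moment, so it is close to μF. The sets met by the
algorithm depend on the noise, so closeness is needed for all sets of at most k elements at once; ℓ
is large enough for the concentration to beat this union bound. Smooth-Greedy is thus almost greedy
for F, with error O(ε OPT / k) per step.

The losses f(⋃ H_i) - f(R_j) sum to at most OPT, so some j loses at most OPT / m. For this j the
greedy recursion from R_j gives nearly (1 - 1/e) OPT (`exists_candidate_value`); the smoothing sets
together consume only an O(ε) fraction of the budget.

It remains to recognize a good candidate from noisy values. An element outside a candidate was
available in each of about k greedy steps, so its marginal value is O(OPT / k)
(`candidate_union_bound`), and a comparison set adds at most β OPT with β = ε²/80. If f(T) > f(U) +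
2β OPT, then f(T ∪ X) exceeds f(U ∪ X) by a constant factor for every X. Each single comparison is
then biased towards T by a constant (`exists_gap`), different X use different multipliers, and
Hoeffding's inequality makes the majority correct (`measureReal_compare_wrong_le`). At most m
comparisons lose 2β OPT each, which is O(ε) OPT in total. -/

namespace NoisySubmodular

/-! ### Submodular functions, smoothing and the greedy recursion -/

section Submodular

variable {N : Type*} [DecidableEq N] {f : Finset N → ℝ}

theorem IsSubmodular.insert_sub_le (hf : IsSubmodular f) (hm : Monotone f) {S T : Finset N}
    (hST : S ⊆ T) (a : N) : f (insert a T) - f T ≤ f (insert a S) - f S := by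
  by_cases ha : a ∈ T
  · rw [insert_eq_of_mem ha]
    have := hm (subset_insert a S)
    simp only [sub_self]; linarith
  · have h := hf (insert a S) T
    have h1 : insert a S ∪ T = insert a T := by
      rw [insert_union, union_eq_right.2 hST]
    have h2 : insert a S ∩ T = S := by
      rw [insert_inter_of_notMem ha, inter_eq_left.2 hST]
    rw [h1, h2] at h
    linarith

theorem IsSubmodular.union_sub_le_sum (hf : IsSubmodular f) (hm : Monotone f) (S O : Finset N) :
    f (S ∪ O) - f S ≤ ∑ b ∈ O, (f (insert b S) - f S) := by
  induction O using Finset.induction_on with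
  | empty => simp
  | insert b O hb ih =>
    rw [sum_insert hb, union_insert]
    have := hf.insert_sub_le hm (subset_union_left : S ⊆ S ∪ O) b
    linarith

/-- Marginal contributions are decreasing, for sets of elements. -/
theorem IsSubmodular.union_sub_le (hf : IsSubmodular f) (hm : Monotone f) {S T : Finset N}
    (hST : S ⊆ T) (A : Finset N) : f (T ∪ A) - f T ≤ f (S ∪ A) - f S := by
  have h := hf (S ∪ A) T
  have h1 : S ∪ A ∪ T = T ∪ A := by
    rw [union_right_comm, union_eq_right.2 hST]
  have h2 : S ≤ (S ∪ A) ∩ T := subset_inter subset_union_left hST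
  rw [h1] at h
  linarith [hm h2]

/-- If finitely many sets are removed from their union one at a time, then the average loss is at
most the average of the value of the union. -/
theorem IsSubmodular.sum_sub_erase_le (hf : IsSubmodular f) (hm : Monotone f) {ι : Type*}
    [DecidableEq ι] (I : Finset ι) (H : ι → Finset N) :
    ∑ j ∈ I, (f (I.biUnion H) - f ((I.erase j).biUnion H)) ≤ f (I.biUnion H) - f ∅ := by
  induction I using Finset.induction_on with
  | empty => simp
  | insert i I hi ih =>
    rw [sum_insert hi, erase_insert hi]
    -- By diminishing returns, deleting `H j` costs less in the presence of `H i`. The summand of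
    -- `i` itself telescopes with the induction hypothesis.
    have key : ∀ j ∈ I, f ((insert i I).biUnion H) - f (((insert i I).erase j).biUnion H) ≤
        f (I.biUnion H) - f ((I.erase j).biUnion H) := by
      intro j hj
      have hji : i ≠ j := fun h => hi (h ▸ hj)
      have h := hf.union_sub_le hm (biUnion_subset_biUnion_of_subset_left H
        (erase_subset_erase j (subset_insert i I))) (H j)
      have e : ∀ J : Finset ι, j ∈ J → (J.erase j).biUnion H ∪ H j = J.biUnion H := by
        intro J hJ
        conv_rhs => rw [← insert_erase hJ, biUnion_insert, union_comm]
      rwa [e _ (mem_insert_of_mem hj), e _ hj] at h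
    have := sum_le_sum key
    linarith

/-- The average of `f (S ∪ X)` over all `X ⊆ H`. -/
noncomputable def smoothAvg (f : Finset N → ℝ) (H S : Finset N) : ℝ :=
  (1 / 2 ^ #H) * ∑ X ∈ H.powerset, f (S ∪ X)

theorem smoothAvg_const (c : ℝ) (H S : Finset N) : smoothAvg (fun _ => c) H S = c := by
  simp [smoothAvg]

theorem smoothAvg_mono_fun {g h : Finset N → ℝ} {H S T : Finset N}
    (hgh : ∀ X ⊆ H, g (S ∪ X) ≤ h (T ∪ X)) : smoothAvg g H S ≤ smoothAvg h H T :=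
  mul_le_mul_of_nonneg_left (sum_le_sum fun X hX => hgh X (mem_powerset.1 hX)) (by positivity)

theorem smoothAvg_monotone (hm : Monotone f) (H : Finset N) : Monotone (smoothAvg f H) :=
  fun _ _ h => smoothAvg_mono_fun fun _ _ => hm (union_subset_union_left h)

theorem le_smoothAvg (hm : Monotone f) (H S : Finset N) : f S ≤ smoothAvg f H S := by
  rw [← smoothAvg_const (f S) H S]
  exact smoothAvg_mono_fun fun _ _ => hm subset_union_left

theorem smoothAvg_le (hm : Monotone f) (H S : Finset N) : smoothAvg f H S ≤ f (S ∪ H) := by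
  rw [← smoothAvg_const (f (S ∪ H)) H S]
  exact smoothAvg_mono_fun fun _ h => hm (union_subset_union_right h)

theorem IsSubmodular.smoothAvg (hf : IsSubmodular f) (H : Finset N) :
    IsSubmodular (smoothAvg f H) := by
  intro S T
  unfold NoisySubmodular.smoothAvg
  rw [← mul_add, ← mul_sub, ← sum_add_distrib, ← sum_sub_distrib]
  refine mul_le_mul_of_nonneg_left (sum_le_sum fun X _ => ?_) (by positivity)
  have h := hf (S ∪ X) (T ∪ X)
  rwa [← inter_union_distrib_right, ← union_union_distrib_right] at h

/-- Adding `A` to `S ∪ H` gains at most what it gains for the smoothed function at `S`. -/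
theorem IsSubmodular.union_sub_le_smoothAvg (hf : IsSubmodular f) (hm : Monotone f)
    (H S A : Finset N) :
    f (S ∪ H ∪ A) - f (S ∪ H) ≤
      NoisySubmodular.smoothAvg f H (S ∪ A) - NoisySubmodular.smoothAvg f H S := by
  rw [← smoothAvg_const (f (S ∪ H ∪ A) - f (S ∪ H)) H S]
  unfold NoisySubmodular.smoothAvg
  rw [← mul_sub, ← sum_sub_distrib]
  refine mul_le_mul_of_nonneg_left (sum_le_sum fun X hX => ?_) (by positivity)
  have h := hf.union_sub_le hm (union_subset_union_right (mem_powerset.1 hX) : S ∪ X ⊆ S ∪ H) A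
  rwa [union_right_comm S X A] at h

/-! ### Approximately greedy sequences -/

variable {S : ℕ → Finset N} {A : Finset N} {e : ℝ} {K : ℕ}

/-- The usual recursion: the best element of `O` gains a `1 / k` share of the deficit `V - f (S i)`,
so each step shrinks the deficit by the factor `1 - 1 / k`, up to `e`. Only `V ≤ f (S i ∪ O)` is
asked, not `V ≤ f O`, because `O` will be an optimal set stripped of the smoothing set. -/
theorem greedy_value_bound (hf : IsSubmodular f) (hm : Monotone f) (hS : Monotone S)
    (hstep : ∀ i < K, ∀ b ∈ A, f (insert b (S i)) ≤ f (S (i + 1)) + e)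
    {O : Finset N} (hOA : O ⊆ A) {k : ℕ} (hk : 0 < k) (hOk : #O ≤ k) (he : 0 ≤ e) {V : ℝ}
    (hV : ∀ i < K, V ≤ f (S i ∪ O)) (h0 : 0 ≤ f (S 0)) :
    V - f (S K) ≤ (1 - 1 / (k : ℝ)) ^ K * V + K * e := by
  have hk' : (1 : ℝ) ≤ k := by exact_mod_cast hk
  have hk1 : 1 / (k : ℝ) ≤ 1 := by rw [div_le_one (by linarith)]; exact hk'
  have hk0 : 0 ≤ 1 / (k : ℝ) := by positivity
  induction K with
  | zero => simp; exact h0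
  | succ K ih =>
    have ih := ih (fun i hi => hstep i (by omega)) (fun i hi => hV i (by omega))
    have h1 : f (S K ∪ O) - f (S K) ≤ k * (f (S (K + 1)) + e - f (S K)) := by
      -- The sign is needed to replace `#O` by the possibly larger `k`.
      have hge : 0 ≤ f (S (K + 1)) + e - f (S K) := by
        have := hm (hS (Nat.le_succ K)); linarith
      calc f (S K ∪ O) - f (S K) ≤ ∑ b ∈ O, (f (insert b (S K)) - f (S K)) :=
            hf.union_sub_le_sum hm _ _
        _ ≤ ∑ b ∈ O, (f (S (K + 1)) + e - f (S K)) :=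
            sum_le_sum fun b hb => by linarith [hstep K (by omega) b (hOA hb)]
        _ = #O * (f (S (K + 1)) + e - f (S K)) := by rw [sum_const, nsmul_eq_mul]
        _ ≤ _ := mul_le_mul_of_nonneg_right (by exact_mod_cast hOk) hge
    have h2 : (1 / (k : ℝ)) * (V - f (S K)) ≤ f (S (K + 1)) + e - f (S K) := by
      rw [div_mul_eq_mul_div, one_mul, div_le_iff₀ (by linarith)]
      linarith [hV K (by omega)]
    have h3 : V - f (S (K + 1)) ≤ (1 - 1 / (k : ℝ)) * (V - f (S K)) + e := by linarith
    have h4 := mul_le_mul_of_nonneg_left ih (sub_nonneg.2 hk1)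
    have h5 : (1 - 1 / (k : ℝ)) * (K * e) ≤ K * e :=
      mul_le_of_le_one_left (by positivity) (by linarith)
    rw [pow_succ']
    push_cast
    linarith

/-- In every step `c` was available, and its marginal value was then at least the final one; hence
each step gained at least that much, up to `e`. The gains telescope. -/
theorem greedy_marginal_bound (hf : IsSubmodular f) (hm : Monotone f) (hS : Monotone S)
    (hstep : ∀ i < K, ∀ b ∈ A, f (insert b (S i)) ≤ f (S (i + 1)) + e)
    {c : N} (hc : c ∈ A) :
    K * (f (insert c (S K)) - f (S K)) ≤ f (S K) - f (S 0) + K * e := by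
  have h : ∀ i < K, f (insert c (S K)) - f (S K) ≤ f (S (i + 1)) - f (S i) + e := by
    intro i hi
    have := hf.insert_sub_le hm (hS hi.le) c
    linarith [hstep i hi c hc]
  have h2 := sum_le_sum fun i (hi : i ∈ range K) => h i (mem_range.1 hi)
  rwa [sum_add_distrib, sum_range_sub (fun i => f (S i)), sum_const, sum_const, card_range,
    nsmul_eq_mul, nsmul_eq_mul] at h2

end Submodular

/-! ### Unions of the smoothing sets -/

section FiniteFamilies

variable {N : Type*} [DecidableEq N] {m l : ℕ} {H : Fin m → Finset N}

theorem biUnion_erase_disjoint (hdisj : ∀ i j, i ≠ j → Disjoint (H i) (H j)) (j : Fin m) :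
    Disjoint ((univ.erase j).biUnion H) (H j) := by
  rw [disjoint_biUnion_left]
  intro i hi
  exact hdisj i j (mem_erase.1 hi).1

theorem biUnion_erase_union (H : Fin m → Finset N) (j : Fin m) :
    (univ.erase j).biUnion H ∪ H j = univ.biUnion H := by
  conv_rhs => rw [← insert_erase (mem_univ j), biUnion_insert, union_comm]

theorem card_biUnion_univ (hcard : ∀ i, #(H i) = l)
    (hdisj : ∀ i j, i ≠ j → Disjoint (H i) (H j)) : #(univ.biUnion H) = m * l := by
  rw [card_biUnion fun i _ j _ => hdisj i j]; simp [hcard]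

theorem card_biUnion_erase (hcard : ∀ i, #(H i) = l)
    (hdisj : ∀ i j, i ≠ j → Disjoint (H i) (H j)) (j : Fin m) :
    #((univ.erase j).biUnion H) + l = m * l := by
  rw [← card_biUnion_univ hcard hdisj, ← biUnion_erase_union H j,
    card_union_of_disjoint (biUnion_erase_disjoint hdisj j), hcard]

end FiniteFamilies

/-! ### Greedy steps, candidates and the tournament -/

section Algorithm

variable {N : Type*} [LinearOrder N]

theorem smoothValue_eq_smoothAvg (q : Finset N → ℝ) (H S : Finset N) (a : N) :
    smoothValue q H S a = smoothAvg q H (insert a S) := by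
  unfold smoothValue smoothAvg
  congr 1
  refine sum_congr rfl fun X _ => ?_
  congr 1
  ext x; simp

theorem smoothCompare_eq (q : Finset N → ℝ) (T U C : Finset N) :
    smoothCompare q T U C = T ∨ smoothCompare q T U C = U := by
  unfold smoothCompare; split_ifs <;> simp

theorem tournament_mem (q : Finset N → ℝ) (C : Finset N → Finset N → Finset N) (T : Finset N)
    (L : List (Finset N)) : tournament q C T L ∈ T :: L := by
  induction L generalizing T with
  | nil => simp [tournament]
  | cons U L ih =>
    have h := ih (smoothCompare q T U (C T U))
    rw [tournament]
    rcases smoothCompare_eq q T U (C T U) with e | e <;> rw [e] at h ⊢ <;>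
      simp only [List.mem_cons] at h ⊢ <;> tauto

variable {f : Finset N → ℝ}

/-- If every comparison returns a set whose value is within `t` of both sets, then the winner of
the tournament loses at most `t` per comparison. -/
theorem tournament_value (q : Finset N → ℝ) (C : Finset N → Finset N → Finset N) {t : ℝ}
    (ht : 0 ≤ t) (P : Finset N → Prop)
    (hP : ∀ T U, P T → P U → f T - t ≤ f (smoothCompare q T U (C T U)) ∧
      f U - t ≤ f (smoothCompare q T U (C T U)))
    (L : List (Finset N)) (T : Finset N) (hL : ∀ U ∈ T :: L, P U) :
    ∀ U ∈ T :: L, f U - L.length * t ≤ f (tournament q C T L) := by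
  induction L generalizing T with
  | nil => intro U hU; simp at hU; simp [tournament, hU]
  | cons U' L ih =>
    have hc := smoothCompare_eq q T U' (C T U')
    have hPc : P (smoothCompare q T U' (C T U')) := by
      rcases hc with e | e <;> rw [e] <;> exact hL _ (by simp)
    have hL' : ∀ U ∈ smoothCompare q T U' (C T U') :: L, P U := by
      intro U hU
      rcases List.mem_cons.1 hU with rfl | h
      · exact hPc
      · exact hL _ (by simp [h])
    have ih := ih _ hL'
    have h2 := hP T U' (hL _ (by simp)) (hL _ (by simp))
    have h3 := ih _ List.mem_cons_self
    intro U hU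
    rw [tournament]
    push_cast [List.length_cons]
    simp only [List.mem_cons] at hU
    rcases hU with rfl | rfl | hU
    · linarith [h2.1]
    · linarith [h2.2]
    · linarith [ih U (by simp [hU])]

variable [Fintype N] {q : Finset N → ℝ} {H S : Finset N} {k : ℕ}

theorem greedyStep_cases (q : Finset N → ℝ) (H S : Finset N) :
    (H ∪ S = univ ∧ greedyStep q H S = S) ∨
      ∃ a, a ∉ H ∪ S ∧ greedyStep q H S = insert a S ∧
        ∀ b, b ∉ H ∪ S → smoothAvg q H (insert b S) ≤ smoothAvg q H (insert a S) := by
  by_cases hne : (argmaxSet q H S).Nonempty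
  · right
    have hmem := min'_mem _ hne
    have hmem2 := mem_filter.1 hmem
    refine ⟨_, mem_compl.1 hmem2.1, by rw [greedyStep, dif_pos hne], fun b hb => ?_⟩
    have := hmem2.2 b (mem_compl.2 hb)
    rwa [smoothValue_eq_smoothAvg, smoothValue_eq_smoothAvg] at this
  · left
    refine ⟨?_, by rw [greedyStep, dif_neg hne]⟩
    by_contra h
    have hc : ((H ∪ S)ᶜ).Nonempty := by
      rw [nonempty_iff_ne_empty, Ne, compl_eq_empty_iff]; exact h
    obtain ⟨a, ha, hmax⟩ := exists_max_image _ (smoothValue q H S) hc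
    exact hne ⟨a, mem_filter.2 ⟨ha, hmax⟩⟩

theorem subset_greedyStep (q : Finset N → ℝ) (H S : Finset N) : S ⊆ greedyStep q H S := by
  rcases greedyStep_cases q H S with ⟨_, h⟩ | ⟨a, _, h, _⟩ <;> rw [h]
  exact subset_insert a S

theorem monotone_iterate_greedyStep (q : Finset N → ℝ) (H R : Finset N) :
    Monotone fun i => (greedyStep q H)^[i] R :=
  monotone_nat_of_le_succ fun i => by
    rw [Function.iterate_succ_apply']; exact subset_greedyStep q H _

theorem disjoint_iterate_greedyStep (q : Finset N → ℝ) (hR : Disjoint R H) (i : ℕ) :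
    Disjoint ((greedyStep q H)^[i] R) H := by
  induction i with
  | zero => exact hR
  | succ i ih =>
    rw [Function.iterate_succ_apply']
    rcases greedyStep_cases q H ((greedyStep q H)^[i] R) with ⟨_, h⟩ | ⟨a, ha, h, _⟩ <;> rw [h]
    · exact ih
    · rw [disjoint_insert_left]
      exact ⟨fun h => ha (mem_union_left _ h), ih⟩

theorem card_iterate_greedyStep_le (q : Finset N → ℝ) (H R : Finset N) (i : ℕ) :
    #((greedyStep q H)^[i] R) ≤ #R + i := by
  induction i with
  | zero => simp
  | succ i ih =>
    rw [Function.iterate_succ_apply']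
    rcases greedyStep_cases q H ((greedyStep q H)^[i] R) with ⟨_, h⟩ | ⟨a, ha, h, _⟩ <;> rw [h]
    · omega
    · exact (card_insert_le _ _).trans (by omega)

theorem iterate_greedyStep_full (q : Finset N → ℝ) (H R : Finset N) (i : ℕ) :
    H ∪ (greedyStep q H)^[i] R = univ ∨ #((greedyStep q H)^[i] R) = #R + i := by
  induction i with
  | zero => simp
  | succ i ih =>
    rw [Function.iterate_succ_apply']
    rcases greedyStep_cases q H ((greedyStep q H)^[i] R) with ⟨h, h'⟩ | ⟨a, ha, h, _⟩
    · rw [h']; exact Or.inl h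
    · rw [h]
      rcases ih with ih | ih
      · rw [ih] at ha; simp at ha
      · right
        rw [card_insert_of_notMem fun h => ha (mem_union_right _ h), ih]; omega

/-- An oracle `q` whose smoothed values are close to `μ` times those of `f`, for all sets that
together with `H` have at most `k` elements. -/
def SmoothClose (q f : Finset N → ℝ) (μ t : ℝ) (k : ℕ) (H : Finset N) : Prop :=
  ∀ V : Finset N, Disjoint V H → #(V ∪ H) ≤ k →
    |smoothAvg q H V - μ * smoothAvg f H V| ≤ μ * t

/-- The chosen element beats `b` in noisy value, and each of the two noisy values is off by at most
`μ * t`; dividing by `μ` leaves the loss `2 * t`. The strict bound on the sizes keeps the enlarged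
set within the range of `SmoothClose`. -/
theorem SmoothClose.greedyStep_le {μ t : ℝ} (h : SmoothClose q f μ t k H) (hμ : 0 < μ)
    (ht : 0 ≤ t) (hm : Monotone f) (hS : Disjoint S H) (hk : #S + #H < k) {b : N} (hb : b ∉ H) :
    smoothAvg f H (insert b S) ≤ smoothAvg f H (greedyStep q H S) + 2 * t := by
  by_cases hbS : b ∈ S
  · rw [insert_eq_of_mem hbS]
    linarith [smoothAvg_monotone hm H (subset_greedyStep q H S)]
  rcases greedyStep_cases q H S with ⟨h1, h2⟩ | ⟨a, ha, h1, h2⟩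
  · have : b ∈ H ∪ S := h1 ▸ mem_univ b
    simp [hb, hbS] at this
  · rw [h1]
    have key : ∀ c, c ∉ H → |smoothAvg q H (insert c S) - μ * smoothAvg f H (insert c S)| ≤
        μ * t := fun c hc => h _ (disjoint_insert_left.2 ⟨hc, hS⟩) (by
          have h1 := card_union_le (insert c S) H
          have h2 := card_insert_le c S
          omega)
    have k1 := abs_le.1 (key a fun h => ha (mem_union_left _ h))
    have k2 := abs_le.1 (key b hb)
    have k3 := h2 b (by simp [hb, hbS])
    have : μ * smoothAvg f H (insert b S) ≤ μ * (smoothAvg f H (insert a S) + 2 * t) := by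
      linarith [k1.1, k1.2, k2.1, k2.2]
    exact le_of_mul_le_mul_left this hμ

/-! ### The candidates -/

variable {m l : ℕ} {H : Fin m → Finset N}

theorem biUnion_subset_candidate (q : Finset N → ℝ) (k : ℕ) (H : Fin m → Finset N) (j : Fin m) :
    univ.biUnion H ⊆ candidate q k H j := by
  rw [← biUnion_erase_union H j]
  exact union_subset_union_left (monotone_iterate_greedyStep q (H j) _ (Nat.zero_le _))

theorem card_candidate_le (q : Finset N → ℝ) (hcard : ∀ i, #(H i) = l)
    (hdisj : ∀ i j, i ≠ j → Disjoint (H i) (H j)) (hk : m * l ≤ k) (j : Fin m) :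
    #(candidate q k H j) ≤ k := by
  have h1 := card_union_le (smoothGreedy q k ((univ.erase j).biUnion H) (H j)) (H j)
  have h2 := card_iterate_greedyStep_le q (H j) ((univ.erase j).biUnion H)
    (k - #((univ.erase j).biUnion H) - #(H j))
  have h3 := card_biUnion_erase hcard hdisj j
  have h4 := hcard j
  unfold candidate
  unfold smoothGreedy at h1 ⊢
  omega

theorem candidate_eq_univ (q : Finset N → ℝ) (hcard : ∀ i, #(H i) = l)
    (hdisj : ∀ i j, i ≠ j → Disjoint (H i) (H j)) (hk : m * l ≤ k) (hn : Fintype.card N ≤ k)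
    (j : Fin m) : candidate q k H j = univ := by
  have h3 := card_biUnion_erase hcard hdisj j
  have h4 := hcard j
  have h5 := disjoint_iterate_greedyStep q (biUnion_erase_disjoint hdisj j)
    (k - #((univ.erase j).biUnion H) - #(H j))
  unfold candidate smoothGreedy
  rcases iterate_greedyStep_full q (H j) ((univ.erase j).biUnion H)
    (k - #((univ.erase j).biUnion H) - #(H j)) with h | h
  · rw [union_comm, h]
  · refine eq_univ_of_card _ (le_antisymm (card_le_univ _) ?_)
    rw [card_union_of_disjoint h5, h]
    omega

/-- Both candidates contain all smoothing sets, hence share at least `l` elements, and their union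
has at most `2 * k - l`. -/
theorem hasComparisonRoom (q : Finset N → ℝ) (hcard : ∀ i, #(H i) = l)
    (hdisj : ∀ i j, i ≠ j → Disjoint (H i) (H j)) (hk : m * l ≤ k) (hm : 0 < m)
    (hn : 2 * k ≤ Fintype.card N) : HasComparisonRoom q k l H := by
  intro i j _
  have h1 := card_candidate_le q hcard hdisj hk i
  have h2 := card_candidate_le q hcard hdisj hk j
  have h3 := card_union_add_card_inter (candidate q k H i) (candidate q k H j)
  have h4 := card_le_card (subset_inter (biUnion_subset_candidate q k H i)
    (biUnion_subset_candidate q k H j))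
  rw [card_biUnion_univ hcard hdisj] at h4
  have h5 : l ≤ m * l := Nat.le_mul_of_pos_left l hm
  rw [card_compl]
  omega

/-! ### The tournament -/

theorem slickGreedy_eq_candidate (q : Finset N → ℝ) (k : ℕ) (H : Fin m → Finset N)
    (C : Finset N → Finset N → Finset N) (hm : 0 < m) :
    ∃ j, slickGreedy q k H C = candidate q k H j := by
  obtain ⟨m, rfl⟩ := Nat.exists_eq_succ_of_ne_zero hm.ne'
  unfold slickGreedy
  rw [List.ofFn_succ]
  have h := tournament_mem q C (candidate q k H 0) (List.ofFn fun i : Fin m => candidate q k H i.succ)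
  rw [← List.ofFn_succ (f := candidate q k H)] at h
  obtain ⟨j, hj⟩ := (List.mem_ofFn' _ _).1 h
  exact ⟨j, hj.symm⟩

theorem slickGreedy_value (q : Finset N → ℝ) (k : ℕ) (H : Fin m → Finset N)
    (C : Finset N → Finset N → Finset N) {t : ℝ} (ht : 0 ≤ t)
    (hP : ∀ i j, let T := candidate q k H i; let U := candidate q k H j;
      f T - t ≤ f (smoothCompare q T U (C T U)) ∧ f U - t ≤ f (smoothCompare q T U (C T U)))
    (j : Fin m) : f (candidate q k H j) - m * t ≤ f (slickGreedy q k H C) := by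
  have hm : 0 < m := j.pos
  obtain ⟨m, rfl⟩ := Nat.exists_eq_succ_of_ne_zero hm.ne'
  unfold slickGreedy
  rw [List.ofFn_succ]
  have h := tournament_value (f := f) q C ht (fun T => ∃ i, candidate q k H i = T)
    (by rintro _ _ ⟨i, rfl⟩ ⟨j, rfl⟩; exact hP i j)
    (List.ofFn fun i : Fin m => candidate q k H i.succ) (candidate q k H 0)
    (by
      rw [← List.ofFn_succ (f := candidate q k H)]
      intro U hU
      exact (List.mem_ofFn' _ _).1 hU)
    (candidate q k H j) (by
      rw [← List.ofFn_succ (f := candidate q k H)]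
      exact (List.mem_ofFn' _ _).2 ⟨j, rfl⟩)
  rw [List.length_ofFn] at h
  push_cast
  linarith

end Algorithm

/-! ### Reliable comparisons -/

section Comparison

variable {N : Type*} [LinearOrder N] {q f : Finset N → ℝ} {k l : ℕ}

/-- All comparisons of two sets with values that differ by a factor on all the queried sets are
decided correctly. -/
def ComparesWell (q f : Finset N → ℝ) (r : ℝ) (k l : ℕ)
    (C : Finset N → Finset N → Finset N) : Prop :=
  ∀ T U A : Finset N, (A = C T U ∨ A = C U T) → #T ≤ k → #U ≤ k → Disjoint A (T ∪ U) → #A = l →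
    0 < f T → (∀ X ⊆ A, f (U ∪ X) ≤ r * f (T ∪ X)) → wins q U T A < wins q T U A

theorem ComparesWell.smoothCompare_left {r : ℝ} {C : Finset N → Finset N → Finset N}
    (h : ComparesWell q f r k l C) {T U : Finset N} (hT : #T ≤ k) (hU : #U ≤ k)
    (hA : Disjoint (C T U) (T ∪ U)) (hl : #(C T U) = l) (h0 : 0 < f T)
    (hr : ∀ X ⊆ C T U, f (U ∪ X) ≤ r * f (T ∪ X)) : smoothCompare q T U (C T U) = T := by
  rw [smoothCompare, if_pos (Or.inl (h T U _ (Or.inl rfl) hT hU hA hl h0 hr))]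

/-- The better set is now the second argument, but the comparison set is still `C T U`; this is why
`ComparesWell` admits both orders of the arguments of `C`. -/
theorem ComparesWell.smoothCompare_right {r : ℝ} {C : Finset N → Finset N → Finset N}
    (h : ComparesWell q f r k l C) {T U : Finset N} (hT : #T ≤ k) (hU : #U ≤ k)
    (hA : Disjoint (C T U) (T ∪ U)) (hl : #(C T U) = l) (h0 : 0 < f U)
    (hr : ∀ X ⊆ C T U, f (T ∪ X) ≤ r * f (U ∪ X)) : smoothCompare q T U (C T U) = U := by
  have := h U T (C T U) (Or.inr rfl) hU hT (by rwa [union_comm]) hl h0 hr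
  rw [smoothCompare, if_neg]
  omega

end Comparison

/-! ### The approximation guarantee for a reliable oracle -/

section Guarantee

variable {N : Type*} [Fintype N] {f : Finset N → ℝ} {k : ℕ}

theorem le_optValue (f : Finset N → ℝ) {S : Finset N} (hS : #S ≤ k) : f S ≤ optValue f k :=
  le_sup' f (mem_filter.2 ⟨mem_univ S, hS⟩)

theorem exists_eq_optValue (f : Finset N → ℝ) (k : ℕ) : ∃ O, #O ≤ k ∧ f O = optValue f k := by
  obtain ⟨O, hO, h⟩ := exists_mem_eq_sup' (s := univ.filter fun S : Finset N => #S ≤ k)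
    ⟨∅, by simp⟩ f
  exact ⟨O, (mem_filter.1 hO).2, h.symm⟩

variable [LinearOrder N] {q : Finset N → ℝ} {μ t : ℝ} {m l : ℕ} {H : Fin m → Finset N}

theorem SmoothClose.candidate_step {j : Fin m} (hclose : SmoothClose q f μ t k (H j))
    (hμ : 0 < μ) (ht : 0 ≤ t) (hm : Monotone f) (hcard : ∀ i, #(H i) = l)
    (hdisj : ∀ i j, i ≠ j → Disjoint (H i) (H j)) {i : ℕ} (hi : i < k - m * l)
    {b : N} (hb : b ∈ (H j)ᶜ) :
    smoothAvg f (H j) (insert b ((greedyStep q (H j))^[i] ((univ.erase j).biUnion H))) ≤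
      smoothAvg f (H j) ((greedyStep q (H j))^[i + 1] ((univ.erase j).biUnion H)) + 2 * t := by
  rw [Function.iterate_succ_apply']
  refine hclose.greedyStep_le hμ ht hm
    (disjoint_iterate_greedyStep q (biUnion_erase_disjoint hdisj j) i) ?_ (mem_compl.1 hb)
  have h1 := card_iterate_greedyStep_le q (H j) ((univ.erase j).biUnion H) i
  have h2 := card_biUnion_erase hcard hdisj j
  have h3 := hcard j
  omega

theorem candidate_eq (q : Finset N → ℝ) (hcard : ∀ i, #(H i) = l)
    (hdisj : ∀ i j, i ≠ j → Disjoint (H i) (H j)) (j : Fin m) :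
    candidate q k H j =
      (greedyStep q (H j))^[k - m * l] ((univ.erase j).biUnion H) ∪ H j := by
  have h2 := card_biUnion_erase hcard hdisj j
  have h3 := hcard j
  have h4 : k - #((univ.erase j).biUnion H) - #(H j) = k - m * l := by omega
  rw [candidate, smoothGreedy, h4]

/-- Elements outside a candidate have small marginal contributions to it, since the greedy
algorithm could have chosen them in every step. -/
theorem candidate_union_bound (hf : IsSubmodular f) (hm : Monotone f) (h0 : 0 ≤ f ∅) {j : Fin m}
    (hclose : SmoothClose q f μ t k (H j)) (hμ : 0 < μ) (ht : 0 ≤ t) (hcard : ∀ i, #(H i) = l)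
    (hdisj : ∀ i j, i ≠ j → Disjoint (H i) (H j)) (hk : m * l ≤ k) {X : Finset N}
    (hX : Disjoint X (H j)) :
    (k - m * l : ℕ) * (f (candidate q k H j ∪ X) - f (candidate q k H j)) ≤
      #X * (optValue f k + (k - m * l : ℕ) * (2 * t)) := by
  have hle := le_optValue f (card_candidate_le q hcard hdisj hk j)
  rw [candidate_eq q hcard hdisj j] at hle ⊢
  set S := fun i => (greedyStep q (H j))^[i] ((univ.erase j).biUnion H) with hS
  set K := k - m * l
  have hmono : Monotone S := monotone_iterate_greedyStep q (H j) _
  have hF := hf.smoothAvg (H j)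
  have hFm := smoothAvg_monotone hm (H j)
  have hF0 : 0 ≤ smoothAvg f (H j) (S 0) :=
    (h0.trans (hm (empty_subset _))).trans (le_smoothAvg hm (H j) (S 0))
  have hFK : smoothAvg f (H j) (S K) ≤ optValue f k := (smoothAvg_le hm _ _).trans hle
  -- The gain over the full candidate is passed down to the smoothed function at `S K`, which is the
  -- function the greedy choices control.
  have h1 := hf.union_sub_le_smoothAvg hm (H j) (S K) X
  have h2 := hF.union_sub_le_sum hFm (S K) X
  calc (K : ℝ) * (f (S K ∪ H j ∪ X) - f (S K ∪ H j))
      ≤ K * ∑ c ∈ X, (smoothAvg f (H j) (insert c (S K)) - smoothAvg f (H j) (S K)) :=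
        mul_le_mul_of_nonneg_left (h1.trans h2) (by positivity)
    _ = ∑ c ∈ X, K * (smoothAvg f (H j) (insert c (S K)) - smoothAvg f (H j) (S K)) := mul_sum ..
    _ ≤ ∑ c ∈ X, (optValue f k + K * (2 * t)) := by
        refine sum_le_sum fun c hc => ?_
        have := greedy_marginal_bound hF hFm hmono (A := (H j)ᶜ) (K := K)
          (fun i hi b hb => hclose.candidate_step hμ ht hm hcard hdisj hi hb)
          (mem_compl.2 (disjoint_left.1 hX hc))
        linarith
    _ = _ := by rw [sum_const, nsmul_eq_mul]

/-- Some smoothing set contributes little to the union of all smoothing sets; the candidate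
obtained with it is good. -/
theorem exists_candidate_value (hf : IsSubmodular f) (hm : Monotone f) (h0 : 0 ≤ f ∅)
    (hclose : ∀ j, SmoothClose q f μ t k (H j)) (hμ : 0 < μ) (ht : 0 ≤ t)
    (hcard : ∀ i, #(H i) = l) (hdisj : ∀ i j, i ≠ j → Disjoint (H i) (H j)) (hk : m * l ≤ k)
    (hm0 : 0 < m) (hk0 : 0 < k) :
    ∃ j, (1 - 1 / (m : ℝ)) * optValue f k * (1 - (1 - 1 / (k : ℝ)) ^ (k - m * l)) -
      (k - m * l : ℕ) * (2 * t) ≤ f (candidate q k H j) := by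
  have hmR : (0 : ℝ) < m := by exact_mod_cast hm0
  have hRle : f (univ.biUnion H) ≤ optValue f k :=
    le_optValue f (by rw [card_biUnion_univ hcard hdisj]; exact hk)
  -- Averaging: the `m` losses sum to at most the value of the union, hence to at most the optimum.
  obtain ⟨j, -, hj⟩ : ∃ j ∈ (univ : Finset (Fin m)), f (univ.biUnion H) -
      f ((univ.erase j).biUnion H) ≤ optValue f k / m := by
    refine exists_le_of_sum_le ⟨⟨0, hm0⟩, mem_univ _⟩ ?_
    have := hf.sum_sub_erase_le hm univ H
    rw [sum_const, card_univ, Fintype.card_fin, nsmul_eq_mul, mul_div_cancel₀ _ hmR.ne']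
    linarith
  refine ⟨j, ?_⟩
  rw [candidate_eq q hcard hdisj j]
  set S := fun i => (greedyStep q (H j))^[i] ((univ.erase j).biUnion H) with hS
  set K := k - m * l
  have hmono : Monotone S := monotone_iterate_greedyStep q (H j) _
  have hF := hf.smoothAvg (H j)
  have hFm := smoothAvg_monotone hm (H j)
  have hF0 : 0 ≤ smoothAvg f (H j) (S 0) :=
    (h0.trans (hm (empty_subset _))).trans (le_smoothAvg hm (H j) (S 0))
  obtain ⟨O, hOk, hO⟩ := exists_eq_optValue f k
  -- Only `O \ H j` is available to the greedy algorithm. Adding `H j` back recovers `O` and gains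
  -- no more than over `R_j`, that is, at most a `1 / m` share of the optimum.
  have hV : ∀ i < K, (1 - 1 / (m : ℝ)) * optValue f k ≤
      smoothAvg f (H j) (S i ∪ (O \ H j)) := by
    intro i _
    have e1 : (univ.erase j).biUnion H ⊆ S i ∪ (O \ H j) :=
      (hmono (Nat.zero_le i)).trans subset_union_left
    have e2 := hf.union_sub_le hm e1 (H j)
    rw [biUnion_erase_union] at e2
    have e3 : f O ≤ f (S i ∪ (O \ H j) ∪ H j) := hm fun x hx => by
      by_cases h : x ∈ H j <;> simp [h, hx]
    have e4 := le_smoothAvg hm (H j) (S i ∪ (O \ H j))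
    have e5 : (1 - 1 / (m : ℝ)) * optValue f k = optValue f k - optValue f k / m := by ring
    linarith
  have key := greedy_value_bound hF hFm hmono (A := (H j)ᶜ) (K := K)
    (fun i hi b hb => (hclose j).candidate_step hμ ht hm hcard hdisj hi hb)
    (O := O \ H j) (fun x hx => mem_compl.2 (mem_sdiff.1 hx).2) hk0
    ((card_le_card sdiff_subset).trans hOk) (by positivity) hV hF0
  have := smoothAvg_le hm (H j) (S K)
  linarith

/-- Smooth-Compare loses at most `2 * β` times the optimal value, if adding comparison sets gains
at most `β` times the optimal value. -/
theorem ComparesWell.value_le {β : ℝ} (hβ : 0 < β) (hβ1 : β ≤ 1) (hm : Monotone f)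
    {C : Finset N → Finset N → Finset N} (h : ComparesWell q f (1 - β / 2) k l C)
    {T U : Finset N} (hT : #T ≤ k) (hU : #U ≤ k) (hW : 0 < optValue f k) (h0 : 0 ≤ f ∅)
    (hroom : T ≠ U → Disjoint (C T U) (T ∪ U) ∧ #(C T U) = l)
    (hgT : T ≠ U → ∀ X ⊆ C T U, f (T ∪ X) ≤ f T + β * optValue f k)
    (hgU : T ≠ U → ∀ X ⊆ C T U, f (U ∪ X) ≤ f U + β * optValue f k) :
    f T - 2 * β * optValue f k ≤ f (smoothCompare q T U (C T U)) ∧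
      f U - 2 * β * optValue f k ≤ f (smoothCompare q T U (C T U)) := by
  set W := optValue f k
  have hnn : ∀ S, 0 ≤ f S := fun S => h0.trans (hm (empty_subset S))
  have hβW : 0 < β * W := mul_pos hβ hW
  by_cases hTU : T = U
  · subst hTU
    rcases smoothCompare_eq q T T (C T T) with e | e <;> rw [e] <;> constructor <;> linarith
  obtain ⟨hA, hl⟩ := hroom hTU
  -- The gap of `2βW` shrinks to at least `βW` when `X` is added, and `f (P ∪ X) ≤ 2W`, so it is at
  -- least the fraction `β / 2` of `f (P ∪ X)`.
  have aux : ∀ P Q X : Finset N, #P ≤ k → f (P ∪ X) ≤ f P + β * W → f (Q ∪ X) ≤ f Q + β * W →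
      f Q + 2 * β * W < f P → f (Q ∪ X) ≤ (1 - β / 2) * f (P ∪ X) := by
    intro P Q X hP h1 h2 h3
    have h4 : f P ≤ W := le_optValue f hP
    have h5 : f P ≤ f (P ∪ X) := hm subset_union_left
    have h6 : β * W ≤ W := mul_le_of_le_one_left hW.le hβ1
    have h7 : β / 2 * f (P ∪ X) ≤ β / 2 * (2 * W) :=
      mul_le_mul_of_nonneg_left (by linarith) (by linarith)
    linarith
  rcases lt_or_ge (f U + 2 * β * W) (f T) with h1 | h1
  · rw [h.smoothCompare_left hT hU hA hl (by linarith [hnn U])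
      fun X hX => aux T U X hT (hgT hTU X hX) (hgU hTU X hX) h1]
    constructor <;> linarith
  rcases lt_or_ge (f T + 2 * β * W) (f U) with h2 | h2
  · rw [h.smoothCompare_right hT hU hA hl (by linarith [hnn T])
      fun X hX => aux U T X hU (hgU hTU X hX) (hgT hTU X hX) h2]
    constructor <;> linarith
  rcases smoothCompare_eq q T U (C T U) with e | e <;> rw [e] <;> constructor <;> linarith

theorem numSets_bounds {ε : ℝ} (hε : 0 < ε) (hε1 : ε ≤ 1) :
    6 ≤ ε * numSets ε ∧ ε * numSets ε ≤ 7 := by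
  have h1 : 6 / ε ≤ numSets ε := Nat.le_ceil _
  have h2 : (numSets ε : ℝ) < 6 / ε + 1 := Nat.ceil_lt_add_one (by positivity)
  rw [div_le_iff₀ hε] at h1
  have h3 : ε * numSets ε ≤ ε * (6 / ε + 1) := mul_le_mul_of_nonneg_left h2.le hε.le
  have h4 : ε * (6 / ε + 1) = 6 + ε := by field_simp
  constructor <;> linarith

/-- Here `x` is the fraction of the budget spent on smoothing sets. The power is at most `exp (x -
1)`, which exceeds `1 / e` by at most `ε / 10`; the factor `1 - 1 / M` costs another `ε / 6`, and `1
/ 10 + 1 / 6 < 0.3`. -/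
theorem numeric_value_bound {ε x M : ℝ} {k K : ℕ} (hε : 0 < ε) (hε1 : ε ≤ 1)
    (hM : 6 ≤ ε * M) (hk : 0 < k) (hx : x ≤ 7 / 92 * ε) (hx0 : 0 ≤ x) (hK : (K : ℝ) = k * (1 - x)) :
    1 - 1 / Real.exp 1 - 0.3 * ε ≤ (1 - 1 / M) * (1 - (1 - 1 / (k : ℝ)) ^ K) := by
  have hk' : (1 : ℝ) ≤ k := by exact_mod_cast hk
  have hM0 : 0 < M := by
    by_contra h
    have := mul_nonpos_of_nonneg_of_nonpos hε.le (not_lt.1 h)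
    linarith
  have hMε : 1 / M ≤ ε / 6 := by rw [div_le_div_iff₀ hM0 (by norm_num)]; linarith
  have hp : (1 - 1 / (k : ℝ)) ^ K ≤ Real.exp (x - 1) := by
    calc (1 - 1 / (k : ℝ)) ^ K ≤ Real.exp (-(1 / (k : ℝ))) ^ K := by
          refine pow_le_pow_left₀ ?_ (Real.one_sub_le_exp_neg _) K
          rw [sub_nonneg, div_le_one (by linarith)]; exact hk'
      _ = Real.exp (x - 1) := by
          rw [← Real.exp_nat_mul, hK]; congr 1; field_simp; ring
  have he : Real.exp (x - 1) ≤ 1 / Real.exp 1 + ε / 10 := by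
    have h1 : Real.exp (x - 1) = Real.exp x * (1 / Real.exp 1) := by
      rw [Real.exp_sub]; ring
    have h2 : Real.exp x ≤ 1 + x + x ^ 2 := by
      have := Real.abs_exp_sub_one_sub_id_le (x := x) (by rw [abs_of_nonneg hx0]; linarith)
      linarith [(abs_le.1 this).2]
    have h3 : 1 / Real.exp 1 ≤ 1 / 2 := by
      have := Real.exp_one_gt_d9
      exact one_div_le_one_div_of_le (by norm_num) (by linarith)
    have h4 : x ^ 2 ≤ x := by nlinarith
    have h5 : 0 < 1 / Real.exp 1 := by positivity
    rw [h1]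
    nlinarith
  have hE : 0 < Real.exp (x - 1) := Real.exp_pos _
  have hp0 : 0 ≤ (1 - 1 / (k : ℝ)) ^ K := by
    refine pow_nonneg ?_ K
    rw [sub_nonneg, div_le_one (by linarith)]; exact hk'
  have hM1 : 0 < 1 / M := by positivity
  nlinarith

/-- The guarantee of Slick-Greedy, for an oracle whose smoothed values and comparisons are
reliable. -/
theorem slickGreedy_guarantee {ε : ℝ} (hε : 0 < ε) (hε1 : ε ≤ 1) (hmε : m = numSets ε)
    (hf : IsSubmodular f) (hm : Monotone f) (h0 : 0 ≤ f ∅) (hμ : 0 < μ)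
    (hW : 0 < optValue f k) (hk0 : 0 < k) (hl : (l : ℝ) ≤ ε ^ 2 / 92 * k)
    (hcard : ∀ i, #(H i) = l) (hdisj : ∀ i j, i ≠ j → Disjoint (H i) (H j)) (hk : m * l ≤ k)
    (hclose : ∀ j, SmoothClose q f μ (ε / (100 * k) * optValue f k) k (H j))
    {C : Finset N → Finset N → Finset N}
    (hC : ∀ T U, l ≤ #(T ∪ U)ᶜ → Disjoint (C T U) (T ∪ U) ∧ #(C T U) = l)
    (hcmp : ComparesWell q f (1 - ε ^ 2 / 80 / 2) k l C)
    (hroom : HasComparisonRoom q k l H) :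
    (1 - 1 / Real.exp 1 - ε) * optValue f k ≤ f (slickGreedy q k H C) := by
  set W := optValue f k with hWdef
  have hkR : (0 : ℝ) < k := by exact_mod_cast hk0
  have hb := numSets_bounds hε hε1
  rw [← hmε] at hb
  have hm0 : 0 < m := by
    rcases Nat.eq_zero_or_pos m with h | h
    · rw [h] at hb; norm_num at hb
    · exact h
  set t := ε / (100 * k) * W with htdef
  have ht : 0 ≤ t := by positivity
  set K := k - m * l with hKdef
  have hml : (m : ℝ) * l ≤ 7 / 92 * ε * k := by
    calc (m : ℝ) * l ≤ m * (ε ^ 2 / 92 * k) := mul_le_mul_of_nonneg_left hl (by positivity)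
      _ = (ε * m) * (ε / 92 * k) := by ring
      _ ≤ 7 * (ε / 92 * k) := mul_le_mul_of_nonneg_right hb.2 (by positivity)
      _ = _ := by ring
  have hKR : (K : ℝ) = k - m * l := by rw [hKdef, Nat.cast_sub hk]; push_cast; ring
  have hKge : 85 / 92 * (k : ℝ) ≤ K := by
    have : 7 / 92 * ε * k ≤ 7 / 92 * k :=
      mul_le_mul_of_nonneg_right (by linarith) hkR.le
    rw [hKR]; linarith
  have hKle : (K : ℝ) ≤ k := by rw [hKR]; have : (0 : ℝ) ≤ m * l := by positivity
                                linarith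
  have hkt : k * (2 * t) = ε / 50 * W := by rw [htdef]; field_simp; norm_num
  have hKt : K * (2 * t) ≤ ε / 50 * W := by
    rw [← hkt]; exact mul_le_mul_of_nonneg_right hKle (by positivity)
  obtain ⟨j, hj⟩ := exists_candidate_value hf hm h0 hclose hμ ht hcard hdisj hk hm0 hk0
  -- comparison sets add little to a candidate
  have hgain : ∀ i (X : Finset N), Disjoint X (H i) → #X ≤ l →
      f (candidate q k H i ∪ X) ≤ f (candidate q k H i) + ε ^ 2 / 80 * W := by
    intro i X hX hXl
    have h1 := candidate_union_bound hf hm h0 (hclose i) hμ ht hcard hdisj hk hX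
    have hX' : (#X : ℝ) ≤ ε ^ 2 / 92 * k := le_trans (by exact_mod_cast hXl) hl
    have h2 : (#X : ℝ) * (W + K * (2 * t)) ≤ (ε ^ 2 / 92 * k) * (W + W / 50) := by
      have : ε / 50 * W ≤ W / 50 := by nlinarith
      exact mul_le_mul hX' (by linarith) (by positivity) (by positivity)
    -- Since `K ≥ 85 k / 92`, this reduces to `51 / 50 ≤ 85 / 80`.
    have h3 : (ε ^ 2 / 92 * k) * (W + W / 50) ≤ K * (ε ^ 2 / 80 * W) := by
      have : (85 / 92 * (k : ℝ)) * (ε ^ 2 / 80 * W) ≤ K * (ε ^ 2 / 80 * W) :=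
        mul_le_mul_of_nonneg_right hKge (by positivity)
      have h4 : 0 ≤ ε ^ 2 * k * W := by positivity
      linarith
    have hK0 : (0 : ℝ) < K := by linarith
    have := le_of_mul_le_mul_left (h1.trans (h2.trans h3)) hK0
    linarith
  have hdis : ∀ i (X S : Finset N), Disjoint S (candidate q k H i) → X ⊆ S →
      Disjoint X (H i) := by
    intro i X S hS hXS
    refine disjoint_of_subset_left hXS (disjoint_of_subset_right ?_ hS)
    rw [candidate]; exact subset_union_right
  have hval := slickGreedy_value (f := f) q k H C (t := 2 * (ε ^ 2 / 80) * W) (by positivity)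
    (fun i i' => hcmp.value_le (by positivity) (by nlinarith) hm
      (card_candidate_le q hcard hdisj hk i) (card_candidate_le q hcard hdisj hk i') hW h0
      (fun hne => hC _ _ (hroom i i' hne))
      (fun hne X hX => by
        obtain ⟨h1, h2⟩ := hC _ _ (hroom i i' hne)
        exact hgain i X (hdis i X _ (disjoint_of_subset_right subset_union_left h1) hX)
          (h2 ▸ card_le_card hX))
      (fun hne X hX => by
        obtain ⟨h1, h2⟩ := hC _ _ (hroom i i' hne)
        exact hgain i' X (hdis i' X _ (disjoint_of_subset_right subset_union_right h1) hX)
          (h2 ▸ card_le_card hX))) j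
  have hnum := numeric_value_bound (x := m * l / k) (K := K) hε hε1 hb.1 hk0
    (by rw [div_le_iff₀ hkR]; exact hml) (by positivity) (by rw [hKR]; field_simp)
  have hnumW := mul_le_mul_of_nonneg_right hnum hW.le
  have hloss : (m : ℝ) * (2 * (ε ^ 2 / 80) * W) ≤ 7 / 40 * ε * W := by
    have : (ε * m) * (ε * W / 40) ≤ 7 * (ε * W / 40) :=
      mul_le_mul_of_nonneg_right hb.2 (by positivity)
    linarith
  have hεW : 0 < ε * W := mul_pos hε hW
  -- The three losses are `0.3 ε` from the greedy recursion, `ε / 50` from the noise in its steps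
  -- and `7 ε / 40` from the tournament, less than `ε` together.
  linarith

end Guarantee

/-! ### Exponential moments of the multipliers -/

section Moments

open Filter Topology

/-- A convergent sum of powers with leading exponent at least `1` and positive leading coefficient
eventually exceeds a linear function. -/
theorem exists_linear_le_of_hasSum_rpow {x₀ : ℝ} {a α : ℕ → ℝ} {g : ℝ → ℝ} (hx₀ : 0 < x₀)
    (hα : Antitone α) (h1 : 1 ≤ α 0) (h01 : α 1 < α 0) (ha : 0 < a 0)
    (hg : ∀ x, x₀ < x → HasSum (fun i => a i * x ^ α i) (g x)) :
    ∃ c > 0, ∃ M, x₀ ≤ M ∧ ∀ x, M < x → c * x ≤ g x := by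
  set y := x₀ + 1 with hy
  have hy0 : 0 < y := by linarith
  -- Absolute convergence at the fixed point `y` controls the tail for all `x > y`: it is at most `B
  -- * (x / y) ^ α 1`, which is negligible against `x ^ α 0`.
  have hsum : Summable fun i => |a (i + 1) * y ^ α (i + 1)| :=
    ((summable_nat_add_iff 1).2 (hg y (by linarith)).summable).abs
  set B := ∑' i, |a (i + 1) * y ^ α (i + 1)| with hB
  have hB0 : 0 ≤ B := tsum_nonneg fun i => abs_nonneg _
  have hlim : Tendsto (fun x : ℝ => B / y ^ α 1 * x ^ (-(α 0 - α 1))) atTop (𝓝 0) := by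
    have := (tendsto_rpow_neg_atTop (sub_pos.2 h01)).const_mul (B / y ^ α 1)
    rwa [mul_zero] at this
  obtain ⟨M, hM⟩ := eventually_atTop.1 (hlim.eventually (gt_mem_nhds (half_pos ha)))
  refine ⟨a 0 / 2, half_pos ha, max M y, le_max_of_le_right (by linarith), fun x hx => ?_⟩
  obtain ⟨hxM, hxy⟩ := max_lt_iff.1 hx
  have hx0 : 0 < x := hy0.trans hxy
  have hx1 : 1 ≤ x := by linarith
  have htail : HasSum (fun i => a (i + 1) * x ^ α (i + 1)) (g x - a 0 * x ^ α 0) := by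
    simpa using (hasSum_nat_add_iff' 1).2 (hg x (by linarith))
  have hbound : ∀ i, -(|a (i + 1) * y ^ α (i + 1)| * (x / y) ^ α 1) ≤
      a (i + 1) * x ^ α (i + 1) := by
    intro i
    have e1 : x ^ α (i + 1) = y ^ α (i + 1) * (x / y) ^ α (i + 1) := by
      rw [← Real.mul_rpow hy0.le (by positivity), mul_div_cancel₀ _ hy0.ne']
    have e2 : (x / y) ^ α (i + 1) ≤ (x / y) ^ α 1 :=
      Real.rpow_le_rpow_of_exponent_le ((one_le_div hy0).2 hxy.le) (hα (by omega))
    have e3 : 0 ≤ (x / y) ^ α (i + 1) := by positivity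
    rw [e1, ← mul_assoc]
    calc -(|a (i + 1) * y ^ α (i + 1)| * (x / y) ^ α 1)
        ≤ -(|a (i + 1) * y ^ α (i + 1)| * (x / y) ^ α (i + 1)) :=
          neg_le_neg (mul_le_mul_of_nonneg_left e2 (abs_nonneg _))
      _ = -|a (i + 1) * y ^ α (i + 1)| * (x / y) ^ α (i + 1) := by ring
      _ ≤ _ := mul_le_mul_of_nonneg_right (neg_abs_le _) e3
  have hle : -(B * (x / y) ^ α 1) ≤ g x - a 0 * x ^ α 0 :=
    hasSum_le hbound (hsum.hasSum.mul_right _).neg htail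
  have hM' := hM x hxM.le
  have e4 : B * (x / y) ^ α 1 = B / y ^ α 1 * x ^ (-(α 0 - α 1)) * x ^ α 0 := by
    rw [mul_assoc, ← Real.rpow_add hx0, Real.div_rpow hx0.le hy0.le]
    ring_nf
  have hp : 0 < x ^ α 0 := by positivity
  have e5 : B * (x / y) ^ α 1 ≤ a 0 / 2 * x ^ α 0 := by
    rw [e4]; exact mul_le_mul_of_nonneg_right hM'.le hp.le
  have e6 : x ≤ x ^ α 0 := by
    simpa using Real.rpow_le_rpow_of_exponent_le hx1 h1
  have e7 := mul_le_mul_of_nonneg_left e6 (half_pos ha).le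
  linarith

/-- Far out the density is at most `exp (-c x)`, so the exponential rate `c / 2` is integrable. -/
theorem HasExponentialUpperTail.integrable_exp {D : Measure ℝ} (h : HasExponentialUpperTail D) :
    ∃ s > 0, ∃ M : ℝ, IntegrableOn (fun x => Real.exp (s * x)) (Set.Ioi M) D := by
  obtain ⟨x₀, a, α, g, hx₀, hα, h1, h01, ha, hg, hD⟩ := h
  obtain ⟨c, hc, M, hM, hlin⟩ := exists_linear_le_of_hasSum_rpow hx₀ hα h1 h01 ha hg
  refine ⟨c / 2, half_pos hc, M, ?_⟩
  have hres : D.restrict (Set.Ioi M) ≤ (volume.restrict (Set.Ioi M)).withDensity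
      fun x => ENNReal.ofReal (Real.exp (-(c * x))) := by
    have e : D.restrict (Set.Ioi M) = (volume.restrict (Set.Ioi M)).withDensity
        fun x => ENNReal.ofReal (Real.exp (-g x)) := by
      have := congrArg (fun ν : Measure ℝ => ν.restrict (Set.Ioi M)) hD
      rwa [restrict_withDensity measurableSet_Ioi, Measure.restrict_restrict measurableSet_Ioi,
        Measure.restrict_restrict measurableSet_Ioi, Set.inter_eq_left.2 (Set.Ioi_subset_Ioi hM)]
        at this
    rw [e]
    refine withDensity_mono ?_
    filter_upwards [ae_restrict_mem measurableSet_Ioi] with x hx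
    exact ENNReal.ofReal_le_ofReal (Real.exp_le_exp.2 (neg_le_neg (hlin x hx)))
  refine Integrable.mono_measure ?_ hres
  rw [integrable_withDensity_iff_integrable_smul' (by fun_prop)
    (ae_of_all _ fun _ => ENNReal.ofReal_lt_top)]
  have : (fun x : ℝ => (ENNReal.ofReal (Real.exp (-(c * x)))).toReal • Real.exp (c / 2 * x)) =
      fun x => Real.exp (-(c / 2) * x) := by
    ext x
    rw [ENNReal.toReal_ofReal (Real.exp_pos _).le, smul_eq_mul, ← Real.exp_add]
    ring_nf
  rw [this]
  exact exp_neg_integrableOn_Ioi M (half_pos hc)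

variable {D : Measure ℝ} [IsProbabilityMeasure D]

/-- The tail assumption enters the proof only through this moment. The lower tail is harmless for
non-negative multipliers, and Gaussian laws have all exponential moments. -/
theorem exists_integrable_exp_mul_abs (hD : HasGeneralizedExponentialTail D)
    (hD' : IsMultiplierLaw D) : ∃ s > 0, Integrable (fun x => Real.exp (s * |x|)) D := by
  rcases hD' with ⟨hnn, -⟩ | ⟨m, v, hm, rfl⟩
  · rcases hD with h | ⟨a, b, hab, -⟩
    · obtain ⟨s, hs, M, hint⟩ := h.integrable_exp
      refine ⟨s, hs, ?_⟩
      have h2 : IntegrableOn (fun x => Real.exp (s * |x|)) (Set.Ioi M) D := by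
        refine hint.congr ?_
        filter_upwards [ae_restrict_of_ae hnn] with x hx
        simp only [abs_of_nonneg hx]
      have h3 : IntegrableOn (fun x => Real.exp (s * |x|)) (Set.Iic M) D := by
        refine Integrable.of_mem_Icc 0 (Real.exp (s * M)) (by fun_prop) ?_
        filter_upwards [ae_restrict_of_ae hnn, ae_restrict_mem measurableSet_Iic] with x hx hxM
        rw [abs_of_nonneg hx]
        exact ⟨(Real.exp_pos _).le, Real.exp_le_exp.2 (mul_le_mul_of_nonneg_left hxM hs.le)⟩
      have := h3.union h2
      rwa [Set.Iic_union_Ioi, integrableOn_univ] at this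
    · refine ⟨1, one_pos, Integrable.of_mem_Icc 0 (Real.exp (1 * max |a| |b|)) (by fun_prop) ?_⟩
      have : ∀ᵐ x ∂D, x ∈ Set.Icc a b := hab
      filter_upwards [this] with x hx
      exact ⟨(Real.exp_pos _).le, Real.exp_le_exp.2
        (mul_le_mul_of_nonneg_left (abs_le_max_abs_abs hx.1 hx.2) zero_le_one)⟩
  · exact ⟨1, one_pos, integrable_exp_mul_abs (X := id)
      (integrable_exp_mul_gaussianReal 1) (integrable_exp_mul_gaussianReal (-1))⟩

theorem integral_pos_of_isMultiplierLaw (hint : Integrable (fun x => x) D)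
    (hD' : IsMultiplierLaw D) : 0 < ∫ x, x ∂D := by
  rcases hD' with ⟨hnn, hne⟩ | ⟨m, v, hm, rfl⟩
  · refine lt_of_le_of_ne (integral_nonneg_of_ae hnn) fun h => hne ?_
    exact (integral_eq_zero_iff_of_nonneg_ae hnn hint).1 h.symm
  · rw [integral_id_gaussianReal]; exact hm

theorem abs_exp_sub_one_sub_le (x : ℝ) : |Real.exp x - 1 - x| ≤ x ^ 2 * Real.exp |x| := by
  have h := Complex.norm_exp_sub_sum_le_norm_mul_exp (x : ℂ) 2
  simp only [sum_range_succ, sum_range_zero, pow_zero, Nat.factorial, pow_one] at h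
  have e : Complex.exp x - (0 + 1 / ((1 : ℕ) : ℂ) + x / (((0 + 1) * 1 : ℕ) : ℂ)) =
      ((Real.exp x - 1 - x : ℝ) : ℂ) := by
    push_cast; ring
  rw [e, Complex.norm_real, Complex.norm_real, Real.norm_eq_abs, Real.norm_eq_abs, sq_abs] at h
  exact h

theorem integrable_id_of_exp {D : Measure ℝ} {s : ℝ} (hs : 0 < s)
    (h : Integrable (fun x => Real.exp (s * |x|)) D) : Integrable (fun x => x) D := by
  refine (h.const_mul s⁻¹).mono' (by fun_prop) (ae_of_all _ fun x => ?_)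
  rw [Real.norm_eq_abs, inv_mul_eq_div, le_div_iff₀ hs]
  have := Real.add_one_le_exp (s * |x|)
  linarith

/-- The centred moment generating function is at most quadratically larger than `1` near `0`. -/
theorem exists_mgf_sub_bound {s : ℝ} (hs : 0 < s)
    (h : Integrable (fun x => Real.exp (s * |x|)) D) (μ : ℝ) (hμ : μ = ∫ x, x ∂D) :
    ∃ K > 0, ∃ r > 0, ∀ t : ℝ, |t| ≤ r →
      Integrable (fun x => Real.exp (t * (x - μ))) D ∧
      ∫ x, Real.exp (t * (x - μ)) ∂D ≤ Real.exp (K * t ^ 2) := by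
  have hid := integrable_id_of_exp hs h
  have hint : Integrable (fun x => Real.exp (s * |x - μ|)) D := by
    refine (h.mul_const (Real.exp (s * |μ|))).mono' (by fun_prop) (ae_of_all _ fun x => ?_)
    rw [Real.norm_eq_abs, abs_of_pos (Real.exp_pos _), ← Real.exp_add, ← mul_add]
    exact Real.exp_le_exp.2 (mul_le_mul_of_nonneg_left (abs_sub _ _) hs.le)
  set I := ∫ x, Real.exp (s * |x - μ|) ∂D with hI
  have hI0 : 0 ≤ I := integral_nonneg fun x => (Real.exp_pos _).le
  -- With `|t| ≤ s / 2`, one half of the exponent `s` pays for the Taylor remainder and the other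
  -- half absorbs the factor `(x - μ) ^ 2`. The summand `1` keeps the constant positive.
  refine ⟨8 / s ^ 2 * I + 1, by positivity, s / 2, half_pos hs, fun t ht => ?_⟩
  have hexp : Integrable (fun x => Real.exp (t * (x - μ))) D := by
    refine hint.mono' (by fun_prop) (ae_of_all _ fun x => ?_)
    rw [Real.norm_eq_abs, abs_of_pos (Real.exp_pos _)]
    refine Real.exp_le_exp.2 ((le_abs_self _).trans ?_)
    rw [abs_mul]
    exact mul_le_mul_of_nonneg_right (by linarith) (abs_nonneg _)
  refine ⟨hexp, ?_⟩
  have hpt : ∀ x, Real.exp (t * (x - μ)) ≤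
      1 + t * (x - μ) + 8 / s ^ 2 * t ^ 2 * Real.exp (s * |x - μ|) := by
    intro x
    have h1 := (abs_le.1 (abs_exp_sub_one_sub_le (t * (x - μ)))).2
    have h2 : Real.exp |t * (x - μ)| ≤ Real.exp (s / 2 * |x - μ|) := by
      rw [abs_mul]
      exact Real.exp_le_exp.2 (mul_le_mul_of_nonneg_right ht (abs_nonneg _))
    have h3 : (x - μ) ^ 2 ≤ 8 / s ^ 2 * Real.exp (s / 2 * |x - μ|) := by
      have := Real.quadratic_le_exp_of_nonneg (x := s / 2 * |x - μ|) (by positivity)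
      have h4 : 0 ≤ s / 2 * |x - μ| := by positivity
      rw [div_mul_eq_mul_div, le_div_iff₀ (by positivity), ← sq_abs (x - μ)]
      nlinarith
    have h4 : Real.exp (s * |x - μ|) = Real.exp (s / 2 * |x - μ|) * Real.exp (s / 2 * |x - μ|) := by
      rw [← Real.exp_add]; ring_nf
    have h5 : (t * (x - μ)) ^ 2 * Real.exp |t * (x - μ)| ≤
        t ^ 2 * (8 / s ^ 2 * Real.exp (s / 2 * |x - μ|)) * Real.exp (s / 2 * |x - μ|) := by
      rw [mul_pow]
      exact mul_le_mul (mul_le_mul_of_nonneg_left h3 (sq_nonneg t)) h2 (Real.exp_pos _).le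
        (by positivity)
    rw [h4]
    linarith
  have hlin : Integrable (fun x => 1 + t * (x - μ)) D :=
    (integrable_const 1).add ((hid.sub (integrable_const μ)).const_mul t)
  have hval : ∫ x, (1 + t * (x - μ)) ∂D = 1 := by
    have hsub : Integrable (fun x => x - μ) D := hid.sub (integrable_const μ)
    rw [integral_add (integrable_const 1) (hsub.const_mul t),
      integral_const_mul, integral_sub hid (integrable_const μ), ← hμ]
    simp
  calc ∫ x, Real.exp (t * (x - μ)) ∂D
      ≤ ∫ x, (1 + t * (x - μ) + 8 / s ^ 2 * t ^ 2 * Real.exp (s * |x - μ|)) ∂D :=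
        integral_mono hexp (hlin.add (hint.const_mul _)) hpt
    _ = 1 + 8 / s ^ 2 * t ^ 2 * I := by
        rw [integral_add hlin (hint.const_mul _), hval, integral_const_mul]
    _ ≤ (8 / s ^ 2 * I + 1) * t ^ 2 + 1 := by nlinarith [sq_nonneg t]
    _ ≤ _ := Real.add_one_le_exp _

end Moments

/-! ### A Chernoff bound for weighted sums -/

section Concentration

variable {κ : Type*} [Fintype κ] {D : Measure ℝ} [IsProbabilityMeasure D]

/-- Concentration of weighted sums of independent multipliers. -/
theorem weighted_sum_concentration {μ K r : ℝ} (hK : 0 < K)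
    (hmgf : ∀ t : ℝ, |t| ≤ r → Integrable (fun x => Real.exp (t * (x - μ))) D ∧
      ∫ x, Real.exp (t * (x - μ)) ∂D ≤ Real.exp (K * t ^ 2))
    {W τ : ℝ} (hW : 0 < W) (hτ : 0 ≤ τ) (hτr : τ ≤ 2 * K * r) (I : Finset κ) (w : κ → ℝ)
    (hw0 : ∀ i, 0 ≤ w i) (hw : ∀ i ∈ I, w i ≤ W) :
    (Measure.pi fun _ : κ => D).real {ξ | τ * W * #I < |∑ i ∈ I, w i * (ξ i - μ)|} ≤
      2 * Real.exp (-(τ ^ 2 * #I / (4 * K))) := by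
  set P := Measure.pi fun _ : κ => D
  -- truncating the weights outside `I` allows to treat all indices alike
  set X : κ → (κ → ℝ) → ℝ := fun i ξ => min (w i) W * (ξ i - μ) with hX
  have hind : iIndepFun X P :=
    iIndepFun_pi (μ := fun _ : κ => D) (X := fun i x => min (w i) W * (x - μ))
      fun i => by fun_prop
  have hmeas : ∀ i, Measurable (X i) := fun i => by fun_prop
  have hone : ∀ t : ℝ, |t| * W ≤ r → ∀ i, Integrable (fun ξ => Real.exp (t * X i ξ)) P ∧
      mgf (X i) P t ≤ Real.exp (K * (t ^ 2 * W ^ 2)) := by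
    intro t ht i
    have hmin0 : 0 ≤ min (w i) W := le_min (hw0 i) hW.le
    have habs : |t * min (w i) W| ≤ r := by
      rw [abs_mul, abs_of_nonneg hmin0]
      exact (mul_le_mul_of_nonneg_left (min_le_right _ _) (abs_nonneg _)).trans ht
    obtain ⟨h1, h2⟩ := hmgf _ habs
    constructor
    · have := (measurePreserving_eval (fun _ : κ => D) i).integrable_comp_of_integrable h1
      simpa only [X, Function.comp_def, Function.eval, mul_assoc] using this
    · have h3 := integral_comp_eval (μ := fun _ : κ => D) (i := i) h1.aestronglyMeasurable
      simp only [mgf, X]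
      simp only [mul_assoc] at h2 h3 ⊢
      rw [h3]
      refine h2.trans (Real.exp_le_exp.2 (mul_le_mul_of_nonneg_left ?_ hK.le))
      rw [mul_pow]
      exact mul_le_mul_of_nonneg_left
        (pow_le_pow_left₀ hmin0 (min_le_right _ _) 2) (sq_nonneg t)
  have hsum : ∀ t : ℝ, |t| * W ≤ r →
      Integrable (fun ξ => Real.exp (t * (∑ i ∈ I, X i) ξ)) P ∧
      mgf (∑ i ∈ I, X i) P t ≤ Real.exp (#I * (K * (t ^ 2 * W ^ 2))) := by
    intro t ht
    refine ⟨hind.integrable_exp_mul_sum hmeas fun i _ => (hone t ht i).1, ?_⟩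
    rw [hind.mgf_sum hmeas, Real.exp_nat_mul, ← prod_const]
    exact prod_le_prod (fun i _ => mgf_nonneg) fun i _ => (hone t ht i).2
  -- This `t` minimizes the Chernoff exponent, and `τ ≤ 2 * K * r` says exactly that `t * W` lies in
  -- the range of the moment bound.
  set t := τ / (2 * K * W) with htdef
  have ht0 : 0 ≤ t := by positivity
  have htr : t * W ≤ r := by
    have : t * W = τ / (2 * K) := by rw [htdef]; field_simp
    rw [this, div_le_iff₀ (by positivity)]; linarith
  have hexp : -t * (τ * W * #I) + #I * (K * (t ^ 2 * W ^ 2)) = -(τ ^ 2 * #I / (4 * K)) := by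
    rw [htdef]; field_simp; ring
  have hup : P.real {ξ | τ * W * #I ≤ (∑ i ∈ I, X i) ξ} ≤ Real.exp (-(τ ^ 2 * #I / (4 * K))) := by
    obtain ⟨h1, h2⟩ := hsum t (by rwa [abs_of_nonneg ht0])
    refine (measure_ge_le_exp_mul_mgf _ ht0 h1).trans ?_
    rw [← hexp, Real.exp_add]
    exact mul_le_mul_of_nonneg_left h2 (Real.exp_pos _).le
  have hlo : P.real {ξ | (∑ i ∈ I, X i) ξ ≤ -(τ * W * #I)} ≤
      Real.exp (-(τ ^ 2 * #I / (4 * K))) := by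
    obtain ⟨h1, h2⟩ := hsum (-t) (by rwa [abs_neg, abs_of_nonneg ht0])
    refine (measure_le_le_exp_mul_mgf _ (neg_nonpos.2 ht0) h1).trans ?_
    rw [neg_sq] at h2
    rw [← hexp, Real.exp_add, neg_neg, mul_neg, ← neg_mul]
    exact mul_le_mul_of_nonneg_left h2 (Real.exp_pos _).le
  have hsub : {ξ | τ * W * #I < |∑ i ∈ I, w i * (ξ i - μ)|} ⊆
      {ξ | τ * W * #I ≤ (∑ i ∈ I, X i) ξ} ∪ {ξ | (∑ i ∈ I, X i) ξ ≤ -(τ * W * #I)} := by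
    intro ξ hξ
    have e : (∑ i ∈ I, X i) ξ = ∑ i ∈ I, w i * (ξ i - μ) := by
      rw [Finset.sum_apply]
      exact sum_congr rfl fun i hi => by rw [hX]; simp only [min_eq_left (hw i hi)]
    rw [Set.mem_ofPred_eq] at hξ
    rcases lt_abs.1 hξ with h | h
    · left; simp only [Set.mem_ofPred_eq, e]; exact h.le
    · right; simp only [Set.mem_ofPred_eq, e]; linarith
  calc _ ≤ _ := measureReal_mono hsub
    _ ≤ _ := measureReal_union_le _ _
    _ ≤ _ := by linarith

end Concentration

/-! ### The bias of a single noisy comparison -/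

section Gap

variable {D : Measure ℝ} [IsProbabilityMeasure D]

/-- The sign of `p.2 * u - p.1 * t`: it is `1` if the noisy value `p.1 * t` is smaller than the
noisy value `p.2 * u`, and `-1` if it is larger. -/
noncomputable def lossSign (t u : ℝ) (p : ℝ × ℝ) : ℝ :=
  (if p.1 * t ≤ p.2 * u then 1 else 0) - (if p.2 * u ≤ p.1 * t then 1 else 0)

theorem measurable_lossSign (t u : ℝ) : Measurable (lossSign t u) := by
  refine Measurable.sub ?_ ?_ <;>
    exact Measurable.ite (measurableSet_le (by fun_prop) (by fun_prop)) measurable_const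
      measurable_const

theorem lossSign_mem_Icc (t u : ℝ) (p : ℝ × ℝ) : lossSign t u p ∈ Set.Icc (-1) 1 := by
  unfold lossSign; split_ifs <;> norm_num

theorem lossSign_of_lt {t u : ℝ} {p : ℝ × ℝ} (h : p.2 * u < p.1 * t) : lossSign t u p = -1 := by
  rw [lossSign, if_neg (not_le.2 h), if_pos h.le]; norm_num

theorem lossSign_nonpos {t u : ℝ} {p : ℝ × ℝ} (h : p.2 * u ≤ p.1 * t) : lossSign t u p ≤ 0 := by
  rw [lossSign, if_pos h]; split_ifs <;> norm_num

/-- Symmetrization: as `σ` preserves the measure, twice the mean is the mean of the sum over a point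
and its image, which is at most `0`, and at most `-1` on `J ×ˢ J`. -/
theorem integral_lossSign_le {t u : ℝ} {σ : ℝ × ℝ → ℝ × ℝ}
    (hσ : MeasurePreserving σ (D.prod D) (D.prod D)) {J : Set ℝ} (hJ : MeasurableSet J)
    (h : ∀ᵐ p ∂(D.prod D), lossSign t u p + lossSign t u (σ p) ≤
      -(J ×ˢ J).indicator (fun _ => 1) p) :
    ∫ p, lossSign t u p ∂(D.prod D) ≤ -(D.real J ^ 2 / 2) := by
  have hL := measurable_lossSign t u
  have hint : Integrable (lossSign t u) (D.prod D) :=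
    Integrable.of_mem_Icc (-1) 1 hL.aemeasurable (ae_of_all _ (lossSign_mem_Icc t u))
  have hint' : Integrable (fun p => lossSign t u (σ p)) (D.prod D) :=
    hσ.integrable_comp_of_integrable hint
  have hJJ : MeasurableSet (J ×ˢ J) := hJ.prod hJ
  have e : ∫ p, lossSign t u (σ p) ∂(D.prod D) = ∫ p, lossSign t u p ∂(D.prod D) := by
    conv_rhs => rw [← hσ.map_eq]
    rw [integral_map hσ.measurable.aemeasurable hL.aestronglyMeasurable]
  have hle := integral_mono_ae (hint.add hint')
    (((integrable_const (1 : ℝ)).indicator hJJ).neg) h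
  simp only [Pi.add_apply, Pi.neg_apply] at hle
  rw [integral_add hint hint', e, integral_neg, integral_indicator_const _ hJJ,
    measureReal_prod_prod] at hle
  simp only [smul_eq_mul, mul_one] at hle
  linarith

/-- Symmetrize by swapping the multipliers: the better set wins whenever it has the larger
multiplier. If both lie in an interval `(a, b)` with `r * b ≤ a` and positive mass, it wins in both
orders. -/
theorem exists_gap_of_nonneg (hnn : ∀ᵐ x ∂D, 0 ≤ x) (hne : ¬ ∀ᵐ x ∂D, x = 0) {r : ℝ}
    (hr0 : 0 < r) (hr1 : r < 1) :
    ∃ g > 0, ∀ t u : ℝ, 0 < t → 0 ≤ u → u ≤ r * t →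
      ∫ p, lossSign t u p ∂(D.prod D) ≤ -g := by
  obtain ⟨a, b, ha, hab, hJ⟩ : ∃ a b : ℝ, 0 < a ∧ r * b ≤ a ∧ 0 < D (Set.Ioo a b) := by
    by_contra! hcon
    refine hne ?_
    -- Every `x > 0` is interior to an interval with end points in the exact ratio `r`; if all these
    -- were null, the law would be concentrated at `0`.
    have hnull : D (Set.Ioi 0) = 0 := by
      refine measure_null_of_locally_null _ fun x (hx : 0 < x) =>
        ⟨Set.Ioo ((1 + r) / 2 * x) ((1 + r) / (2 * r) * x), mem_nhdsWithin_of_mem_nhds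
          (Ioo_mem_nhds (by nlinarith) ?_), ?_⟩
      · rw [div_mul_eq_mul_div, lt_div_iff₀ (by positivity)]; nlinarith
      · refine le_antisymm (hcon _ _ (by positivity) (le_of_eq ?_)) zero_le
        field_simp
    have hpos : ∀ᵐ x ∂D, x ∉ Set.Ioi (0 : ℝ) := measure_eq_zero_iff_ae_notMem.1 hnull
    filter_upwards [hnn, hpos] with x h1 h2
    exact le_antisymm (not_lt.1 h2) h1
  have hJ' : 0 < D.real (Set.Ioo a b) := ENNReal.toReal_pos hJ.ne' (measure_ne_top _ _)
  refine ⟨D.real (Set.Ioo a b) ^ 2 / 2, by positivity, fun t u ht hu hut => ?_⟩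
  refine integral_lossSign_le (Measure.measurePreserving_swap) measurableSet_Ioo ?_
  have hut' : u < t := by nlinarith
  have hprod : ∀ᵐ p ∂(D.prod D), 0 ≤ p.1 ∧ 0 ≤ p.2 := by
    have h1 := Measure.quasiMeasurePreserving_fst (μ := D) (ν := D) |>.ae hnn
    have h2 := Measure.quasiMeasurePreserving_snd (μ := D) (ν := D) |>.ae hnn
    filter_upwards [h1, h2] with p h1 h2 using ⟨h1, h2⟩
  filter_upwards [hprod] with ⟨x, y⟩ ⟨hx, hy⟩
  simp only at hx hy
  have key : ∀ x y : ℝ, 0 ≤ x → x ≤ y → lossSign t u (x, y) + lossSign t u (y, x) ≤ 0 := by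
    intro x y hx hxy
    have h1 : x * u ≤ y * t := mul_le_mul hxy hut'.le hu (hx.trans hxy)
    rcases hxy.eq_or_lt with rfl | hlt
    · linarith [lossSign_nonpos (p := (x, x)) h1]
    · have h2 : x * u < y * t :=
        lt_of_le_of_lt (mul_le_mul_of_nonneg_left hut'.le hx) (mul_lt_mul_of_pos_right hlt ht)
      rw [lossSign_of_lt (p := (y, x)) h2]
      linarith [(lossSign_mem_Icc t u (x, y)).2]
  by_cases hp : (x, y) ∈ Set.Ioo a b ×ˢ Set.Ioo a b
  · rw [Set.indicator_of_mem hp]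
    obtain ⟨⟨h1, h2⟩, h3, h4⟩ := hp
    simp only at h1 h2 h3 h4
    have hlt : ∀ x y : ℝ, a < x → 0 ≤ y → y < b → y * u < x * t := by
      intro x y h1 hy h2
      have e1 : y * u ≤ y * (r * t) := mul_le_mul_of_nonneg_left hut hy
      have e2 : y * (r * t) ≤ b * (r * t) :=
        mul_le_mul_of_nonneg_right h2.le (by positivity)
      have e3 : b * (r * t) ≤ a * t := by
        have := mul_le_mul_of_nonneg_right hab ht.le; linarith
      have e4 := mul_lt_mul_of_pos_right h1 ht
      linarith
    rw [Prod.swap_prod_mk, lossSign_of_lt (hlt x y h1 hy h4), lossSign_of_lt (hlt y x h3 hx h2)]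
    norm_num
  · rw [Set.indicator_of_notMem hp, Prod.swap_prod_mk, neg_zero]
    rcases le_total x y with h | h
    · exact key x y hx h
    · rw [add_comm]; exact key y x hy h

/-- Negative multipliers spoil the swap, so both are reflected in the mean `m` instead: the margins
`x * t - y * u` of a point and its image sum to `2 * m * (t - u) > 0`, so at least one is positive.
Within `ρ` of the mean both are: the margin at the mean is at least `4 * ρ * t`, and the
perturbation stays below `2 * ρ * t`. -/
theorem exists_gap_gaussianReal {m : ℝ} (hm : 0 < m) (v : ℝ≥0) {r : ℝ} (hr1 : r < 1) :
    ∃ g > 0, ∀ t u : ℝ, 0 < t → 0 ≤ u → u ≤ r * t →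
      ∫ p, lossSign t u p ∂((gaussianReal m v).prod (gaussianReal m v)) ≤ -g := by
  set D := gaussianReal m v
  set ρ := m * (1 - r) / 4 with hρ
  have hρ0 : 0 < ρ := by have := mul_pos hm (sub_pos.2 hr1); positivity
  set J := Set.Ioo (m - ρ) (m + ρ)
  have hJ : 0 < D J := by
    by_cases hv : v = 0
    · have : D = Measure.dirac m := by simp only [D, hv, gaussianReal_zero_var]
      rw [this, Measure.dirac_apply_of_mem (show m ∈ J from ⟨by linarith, by linarith⟩)]
      exact one_pos
    · refine pos_iff_ne_zero.2 fun h => ?_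
      have := gaussianReal_absolutelyContinuous' m hv h
      rw [Real.volume_Ioo, ENNReal.ofReal_eq_zero] at this
      linarith
  have hJ' : 0 < D.real J := ENNReal.toReal_pos hJ.ne' (measure_ne_top _ _)
  have hrefl : MeasurePreserving (fun x => 2 * m - x) D D :=
    ⟨by fun_prop, by rw [gaussianReal_map_const_sub]; congr 1; ring⟩
  refine ⟨D.real J ^ 2 / 2, by positivity, fun t u ht hu hut => ?_⟩
  refine integral_lossSign_le (hrefl.prod hrefl) measurableSet_Ioo (ae_of_all _ ?_)
  rintro ⟨x, y⟩
  have hmt : m * (1 - r) * t ≤ m * (t - u) := by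
    have := mul_le_mul_of_nonneg_left hut hm.le; linarith
  have hgap : 0 < m * (t - u) := lt_of_lt_of_le (by have := sub_pos.2 hr1; positivity) hmt
  by_cases hp : (x, y) ∈ J ×ˢ J
  · rw [Set.indicator_of_mem hp]
    obtain ⟨⟨h1, h2⟩, h3, h4⟩ := hp
    simp only at h1 h2 h3 h4
    have hut' : u < t := by nlinarith
    have a1 := mul_lt_mul_of_pos_right h1 ht
    have a2 := mul_lt_mul_of_pos_right h2 ht
    have a3 := mul_le_mul_of_nonneg_right h3.le hu
    have a4 := mul_le_mul_of_nonneg_right h4.le hu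
    have a5 := mul_lt_mul_of_pos_left hut' hρ0
    have a6 : m * (1 - r) * t = 4 * (ρ * t) := by rw [hρ]; ring
    rw [lossSign_of_lt (p := (x, y)) (by simp only; linarith), lossSign_of_lt]
    · norm_num
    · simp only [Prod.map]; linarith
  · rw [Set.indicator_of_notMem hp, neg_zero]
    simp only [Prod.map]
    rcases lt_or_ge (y * u) (x * t) with h | h
    · rw [lossSign_of_lt (p := (x, y)) h]
      linarith [(lossSign_mem_Icc t u (2 * m - x, 2 * m - y)).2]
    · rw [lossSign_of_lt (p := (2 * m - x, 2 * m - y)) (by simp only; linarith)]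
      linarith [(lossSign_mem_Icc t u (x, y)).2]

/-- Multiplying one of two independent multipliers by a factor below `1` makes it lose more often
than win. -/
theorem exists_gap (hD' : IsMultiplierLaw D) {r : ℝ} (hr0 : 0 < r) (hr1 : r < 1) :
    ∃ g > 0, ∀ t u : ℝ, 0 < t → 0 ≤ u → u ≤ r * t →
      ∫ p, lossSign t u p ∂(D.prod D) ≤ -g := by
  rcases hD' with ⟨hnn, hne⟩ | ⟨m, v, hm, rfl⟩
  · exact exists_gap_of_nonneg hnn hne hr0 hr1
  · exact exists_gap_gaussianReal hm v hr1

end Gap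

/-! ### Independence and Hoeffding's inequality for pairs of coordinates -/

section Independence

variable {κ : Type*} [Fintype κ] [DecidableEq κ] {D : Measure ℝ} [IsProbabilityMeasure D]

/-- Functions of disjoint sets of coordinates are independent. -/
theorem indepFun_pi_of_disjoint {S T : Finset κ} (hST : Disjoint S T) {F G : (κ → ℝ) → ℝ}
    (hF : Measurable F) (hG : Measurable G)
    (hFS : ∀ ξ η : κ → ℝ, (∀ i ∈ S, ξ i = η i) → F ξ = F η)
    (hGT : ∀ ξ η : κ → ℝ, (∀ i ∈ T, ξ i = η i) → G ξ = G η) :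
    IndepFun F G (Measure.pi fun _ : κ => D) := by
  have hcoord : iIndepFun (fun (i : κ) (ξ : κ → ℝ) => ξ i) (Measure.pi fun _ : κ => D) :=
    iIndepFun_pi (μ := fun _ : κ => D) (X := fun _ x => x) fun _ => aemeasurable_id
  have h := hcoord.indepFun_finset S T hST (fun i => measurable_pi_apply i)
  -- Extending by zero outside `R` turns a function of the coordinates in `R` into one of the
  -- restricted point.
  have hext : ∀ R : Finset κ, Measurable fun (z : R → ℝ) (i : κ) =>
      if h : i ∈ R then z ⟨i, h⟩ else 0 := by
    intro R
    refine measurable_pi_lambda _ fun i => ?_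
    by_cases hi : i ∈ R
    · simp only [hi, dif_pos]; exact measurable_pi_apply _
    · simp only [hi, dif_neg, not_false_eq_true]; exact measurable_const
  have h2 := h.comp (hF.comp (hext S)) (hG.comp (hext T))
  refine h2.congr (ae_of_all _ fun ξ => ?_) (ae_of_all _ fun ξ => ?_)
  · exact hFS _ _ fun i hi => by simp [hi]
  · exact hGT _ _ fun i hi => by simp [hi]

omit [DecidableEq κ] in
theorem map_pair_pi {i j : κ} (hij : i ≠ j) :
    (Measure.pi fun _ : κ => D).map (fun ξ => (ξ i, ξ j)) = D.prod D := by
  have hcoord : iIndepFun (fun (i : κ) (ξ : κ → ℝ) => ξ i) (Measure.pi fun _ : κ => D) :=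
    iIndepFun_pi (μ := fun _ : κ => D) (X := fun _ x => x) fun _ => aemeasurable_id
  have h := (indepFun_iff_map_prod_eq_prod_map_map (measurable_pi_apply i).aemeasurable
    (measurable_pi_apply j).aemeasurable).1 (hcoord.indepFun hij)
  rw [h]
  congr 1
  · exact (measurePreserving_eval (fun _ : κ => D) i).map_eq
  · exact (measurePreserving_eval (fun _ : κ => D) j).map_eq

/-- Hoeffding's inequality for functions of disjoint pairs of coordinates. -/
theorem measureReal_sum_pairs_nonneg_le {ι : Type*} [DecidableEq ι] (I : Finset ι)
    (hI : I.Nonempty) (A B : ι → κ)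
    (hAB : ∀ i ∈ I, A i ≠ B i)
    (hdisj : ∀ i ∈ I, ∀ j ∈ I, i ≠ j → Disjoint ({A i, B i} : Finset κ) {A j, B j})
    (h : ι → ℝ × ℝ → ℝ) (hmeas : ∀ i, Measurable (h i)) (hb : ∀ i p, h i p ∈ Set.Icc (-1) 1)
    {g : ℝ} (hg : 0 < g) (hmean : ∀ i ∈ I, ∫ p, h i p ∂(D.prod D) ≤ -g) :
    (Measure.pi fun _ : κ => D).real {ξ | 0 ≤ ∑ i ∈ I, h i (ξ (A i), ξ (B i))} ≤
      Real.exp (-(g ^ 2 * #I / 2)) := by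
  set P := Measure.pi fun _ : κ => D
  set Y : ι → (κ → ℝ) → ℝ := fun i ξ => h i (ξ (A i), ξ (B i)) with hY
  have hYm : ∀ i, Measurable (Y i) := fun i => (hmeas i).comp (by fun_prop)
  have hone : ∀ i, HasSubgaussianMGF (fun ξ => Y i ξ - P[Y i]) 1 P := by
    intro i
    have := hasSubgaussianMGF_of_mem_Icc (a := -1) (b := 1) (μ := P) (hYm i).aemeasurable
      (ae_of_all _ fun ξ => hb i _)
    convert this using 1
    norm_num
  have hsum : ∀ I' ⊆ I, HasSubgaussianMGF (fun ξ => ∑ i ∈ I', (Y i ξ - P[Y i])) #I' P := by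
    intro I' hI'
    induction I' using Finset.induction_on with
    | empty => simp
    | insert i I' hi ih =>
      have hsub := insert_subset_iff.1 hI'
      have hind : IndepFun (fun ξ => Y i ξ - P[Y i]) (fun ξ => ∑ i ∈ I', (Y i ξ - P[Y i])) P := by
        refine indepFun_pi_of_disjoint (S := {A i, B i})
          (T := I'.biUnion fun j => {A j, B j}) ?_ ((hYm i).sub_const _)
          (Finset.measurable_sum _ fun j _ => (hYm j).sub_const _) ?_ ?_
        · rw [disjoint_biUnion_right]
          exact fun j hj => hdisj i hsub.1 j (hsub.2 hj) fun e => hi (e ▸ hj)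
        · intro ξ η hξ
          simp only [Y, hξ (A i) (by simp), hξ (B i) (by simp)]
        · intro ξ η hξ
          refine sum_congr rfl fun j hj => ?_
          simp only [Y, hξ (A j) (mem_biUnion.2 ⟨j, hj, by simp⟩),
            hξ (B j) (mem_biUnion.2 ⟨j, hj, by simp⟩)]
      have := (hone i).add_of_indepFun (ih hsub.2) hind
      simp only [sum_insert hi, card_insert_of_notMem hi]
      rw [Nat.cast_add, Nat.cast_one, add_comm]
      exact this
  have hEY : ∀ i ∈ I, P[Y i] ≤ -g := by
    intro i hi
    refine le_trans (le_of_eq ?_) (hmean i hi)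
    rw [← map_pair_pi (hAB i hi), integral_map (by fun_prop) (hmeas i).aestronglyMeasurable]
  have hc : (0 : ℝ) < #I := by exact_mod_cast hI.card_pos
  -- A non-negative sum forces the centred sum up to `g * #I`, because every mean is at most `-g`.
  have hfin := (hsum I subset_rfl).measure_ge_le (ε := g * #I) (by positivity)
  refine (measureReal_mono ?_).trans (hfin.trans (Real.exp_le_exp.2 (le_of_eq ?_)))
  · intro ξ hξ
    rw [Set.mem_ofPred_eq] at hξ ⊢
    rw [sum_sub_distrib]
    have := sum_le_sum hEY
    rw [sum_const, nsmul_eq_mul] at this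
    linarith
  · simp only [NNReal.coe_natCast]; field_simp

end Independence

instance isProbabilityMeasure_noiseLaw (N : Type*) [Fintype N] (D : Measure ℝ)
    [IsProbabilityMeasure D] : IsProbabilityMeasure (noiseLaw N D) := by
  unfold noiseLaw; infer_instance

/-! ### One wrong comparison -/

section Compare

variable {N : Type*} [Fintype N] [LinearOrder N] {D : Measure ℝ} [IsProbabilityMeasure D]

/-- A comparison of two sets, one of which is better by a factor on all queried sets, is decided
wrongly with exponentially small probability. -/
theorem measureReal_compare_wrong_le {f : Finset N → ℝ} (hm : Monotone f) (h0 : 0 ≤ f ∅)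
    {g r : ℝ} (hg : 0 < g) (hr1 : r < 1)
    (hgap : ∀ t u : ℝ, 0 < t → 0 ≤ u → u ≤ r * t →
      ∫ p, lossSign t u p ∂(D.prod D) ≤ -g)
    {T U A : Finset N} (hA : Disjoint A (T ∪ U)) (hT : 0 < f T)
    (hr : ∀ X ⊆ A, f (U ∪ X) ≤ r * f (T ∪ X)) :
    (noiseLaw N D).real
      {ξ | ¬ wins (noisyOracle f ξ) U T A < wins (noisyOracle f ξ) T U A} ≤
      Real.exp (-(g ^ 2 * 2 ^ #A / 2)) := by
  have hnn : ∀ S, 0 ≤ f S := fun S => h0.trans (hm (empty_subset S))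
  have hpos : ∀ X, 0 < f (T ∪ X) := fun X => hT.trans_le (hm subset_union_left)
  rw [disjoint_union_right] at hA
  have hTX : ∀ V : Finset N, Disjoint A V → ∀ X ⊆ A, (V ∪ X) ∩ A = X := by
    intro V hV X hX
    rw [union_inter_distrib_right, disjoint_iff_inter_eq_empty.1 hV.symm, empty_union,
      inter_eq_left.2 hX]
  have hTU : ∀ X ⊆ A, T ∪ X ≠ U ∪ X := by
    intro X hX e
    have := hr X hX
    rw [← e] at this
    nlinarith [hpos X]
  have key := measureReal_sum_pairs_nonneg_le (D := D) A.powerset ⟨∅, by simp⟩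
    (fun X => T ∪ X) (fun X => U ∪ X) (fun X hX => hTU X (mem_powerset.1 hX)) ?_
    (fun X => lossSign (f (T ∪ X)) (f (U ∪ X))) (fun X => measurable_lossSign _ _)
    (fun X p => lossSign_mem_Icc _ _ p) hg
    (fun X hX => hgap _ _ (hpos X) (hnn _) (hr X (mem_powerset.1 hX)))
  · rw [card_powerset] at key
    push_cast at key
    refine le_trans (measureReal_mono ?_ (measure_ne_top _ _)) key
    intro ξ hξ
    rw [Set.mem_ofPred_eq] at hξ ⊢
    -- The loss signs add up to the difference of the win counts; ties count for both sides and
    -- cancel.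
    have e : ∑ X ∈ A.powerset, lossSign (f (T ∪ X)) (f (U ∪ X)) (ξ (T ∪ X), ξ (U ∪ X)) =
        wins (noisyOracle f ξ) U T A - wins (noisyOracle f ξ) T U A := by
      simp only [lossSign, wins, noisyOracle, sum_sub_distrib, sum_boole]
      congr!
    rw [e, sub_nonneg]
    exact_mod_cast not_lt.1 hξ
  -- Since `A` misses `T` and `U`, the trace on `A` of each queried set is its `X`; different `X`
  -- therefore query different multipliers.
  · intro X hX Y hY hXY
    have hX := mem_powerset.1 hX
    have hY := mem_powerset.1 hY
    have hne : ∀ V V' : Finset N, Disjoint A V → Disjoint A V' → V ∪ X ≠ V' ∪ Y := by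
      intro V V' hV hV' e
      exact hXY (by rw [← hTX V hV X hX, e, hTX V' hV' Y hY])
    simp only [disjoint_insert_left, disjoint_singleton_left, mem_insert, mem_singleton, not_or]
    exact ⟨⟨hne _ _ hA.1 hA.1, hne _ _ hA.1 hA.2⟩, hne _ _ hA.2 hA.1, hne _ _ hA.2 hA.2⟩

end Compare

/-! ### Union bounds over all sets of bounded size -/

section UnionBound

theorem card_filter_card_le (N : Type*) [Fintype N] [DecidableEq N] (k : ℕ) :
    #(univ.filter fun S : Finset N => #S ≤ k) ≤ (Fintype.card N + 1) ^ k := by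
  induction k with
  | zero =>
    have : (univ.filter fun S : Finset N => #S ≤ 0) = {∅} := by ext S; simp
    rw [this]; simp
  | succ k ih =>
    have hsub : (univ.filter fun S : Finset N => #S ≤ k + 1) ⊆
        ((univ : Finset (Option N)) ×ˢ univ.filter fun S : Finset N => #S ≤ k).image
          fun p => p.1.elim p.2 fun a => insert a p.2 := by
      intro S hS
      have hS := (mem_filter.1 hS).2
      rcases S.eq_empty_or_nonempty with rfl | ⟨a, ha⟩
      · exact mem_image.2 ⟨(none, ∅), by simp, rfl⟩
      · refine mem_image.2 ⟨(some a, S.erase a), ?_, insert_erase ha⟩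
        simp only [mem_product, mem_univ, mem_filter, true_and, card_erase_of_mem ha]
        omega
    refine (card_le_card hsub).trans (card_image_le.trans ?_)
    rw [card_product, card_univ, Fintype.card_option, pow_succ']
    exact Nat.mul_le_mul_left _ ih

variable {N : Type*} [Fintype N] {D : Measure ℝ} [IsProbabilityMeasure D]
  {f : Finset N → ℝ} {k : ℕ}

/-- The sets `V ∪ X` are distinct, so the average involves `2 ^ #H` independent multipliers, with
weights at most the optimum because `V ∪ H` has at most `k` elements. The concentration bound
applies with `τ = μ * η`. -/
theorem measureReal_smoothAvg_far_le [DecidableEq N] (hm : Monotone f) (h0 : 0 ≤ f ∅)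
    {μ K r : ℝ} (hK : 0 < K)
    (hmgf : ∀ t : ℝ, |t| ≤ r → Integrable (fun x => Real.exp (t * (x - μ))) D ∧
      ∫ x, Real.exp (t * (x - μ)) ∂D ≤ Real.exp (K * t ^ 2))
    (hW : 0 < optValue f k) {η : ℝ} (hτ : 0 ≤ μ * η) (hτr : μ * η ≤ 2 * K * r)
    {V H : Finset N} (hV : Disjoint V H) (hVk : #(V ∪ H) ≤ k) :
    (noiseLaw N D).real {ξ | ¬ |smoothAvg (noisyOracle f ξ) H V - μ * smoothAvg f H V| ≤
        μ * (η * optValue f k)} ≤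
      2 * Real.exp (-((μ * η) ^ 2 * 2 ^ #H / (4 * K))) := by
  have hinj : Set.InjOn (fun X => V ∪ X) (H.powerset : Set (Finset N)) := by
    intro X hX Y hY e
    have aux : ∀ X ∈ H.powerset, (V ∪ X) ∩ H = X := fun X hX => by
      rw [union_inter_distrib_right, disjoint_iff_inter_eq_empty.1 hV, empty_union,
        inter_eq_left.2 (mem_powerset.1 hX)]
    rw [← aux X hX, ← aux Y hY]
    exact congrArg (· ∩ H) e
  set I := H.powerset.image fun X => V ∪ X with hI
  have hcard : (#I : ℝ) = 2 ^ #H := by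
    rw [hI, card_image_of_injOn hinj, card_powerset]; push_cast; rfl
  have key := weighted_sum_concentration hK hmgf hW hτ hτr I f
    (fun S => h0.trans (hm (empty_subset S))) (fun S hS => by
      obtain ⟨X, hX, rfl⟩ := mem_image.1 hS
      exact le_optValue f
        ((card_le_card (union_subset_union_right (mem_powerset.1 hX))).trans hVk))
  rw [hcard] at key
  refine le_trans (measureReal_mono ?_ (measure_ne_top _ _)) key
  intro ξ hξ
  rw [Set.mem_ofPred_eq] at hξ ⊢
  have e : smoothAvg (noisyOracle f ξ) H V - μ * smoothAvg f H V =
      (∑ S ∈ I, f S * (ξ S - μ)) / 2 ^ #H := by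
    rw [hI, sum_image hinj, smoothAvg, smoothAvg, sum_div, mul_sum, mul_sum, mul_sum,
      ← sum_sub_distrib]
    refine sum_congr rfl fun X _ => ?_
    rw [noisyOracle]; ring
  have hp : (0 : ℝ) < 2 ^ #H := by positivity
  rw [e, abs_div, abs_of_pos hp, not_le, lt_div_iff₀ hp] at hξ
  linarith

/-- Later greedy sets are chosen with knowledge of the noise, so the bound must hold for all
admissible `V` simultaneously. -/
theorem measureReal_not_smoothClose_le [LinearOrder N] (hm : Monotone f) (h0 : 0 ≤ f ∅)
    {μ K r : ℝ} (hK : 0 < K)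
    (hmgf : ∀ t : ℝ, |t| ≤ r → Integrable (fun x => Real.exp (t * (x - μ))) D ∧
      ∫ x, Real.exp (t * (x - μ)) ∂D ≤ Real.exp (K * t ^ 2))
    (hW : 0 < optValue f k) {η : ℝ} (hτ : 0 ≤ μ * η) (hτr : μ * η ≤ 2 * K * r)
    (H : Finset N) :
    (noiseLaw N D).real {ξ | ¬ SmoothClose (noisyOracle f ξ) f μ (η * optValue f k) k H} ≤
      (Fintype.card N + 1) ^ k * (2 * Real.exp (-((μ * η) ^ 2 * 2 ^ #H / (4 * K)))) := by
  set B := fun V : Finset N => {ξ : Finset N → ℝ | (Disjoint V H ∧ #(V ∪ H) ≤ k) ∧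
    ¬ |smoothAvg (noisyOracle f ξ) H V - μ * smoothAvg f H V| ≤ μ * (η * optValue f k)}
  have hsub : {ξ | ¬ SmoothClose (noisyOracle f ξ) f μ (η * optValue f k) k H} ⊆
      ⋃ V ∈ univ.filter fun S : Finset N => #S ≤ k, B V := by
    intro ξ hξ
    simp only [Set.mem_ofPred_eq, SmoothClose, not_forall] at hξ
    obtain ⟨V, hV, hVk, h⟩ := hξ
    refine Set.mem_biUnion (mem_coe.2 (mem_filter.2 ⟨mem_univ V, ?_⟩)) ⟨⟨hV, hVk⟩, h⟩
    exact (card_le_card subset_union_left).trans hVk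
  have hB : ∀ V ∈ univ.filter fun S : Finset N => #S ≤ k, (noiseLaw N D).real (B V) ≤
      2 * Real.exp (-((μ * η) ^ 2 * 2 ^ #H / (4 * K))) := by
    intro V _
    by_cases hV : Disjoint V H ∧ #(V ∪ H) ≤ k
    · refine (measureReal_mono (fun ξ hξ => hξ.2) (measure_ne_top _ _)).trans
        (measureReal_smoothAvg_far_le hm h0 hK hmgf hW hτ hτr hV.1 hV.2)
    · have : B V = ∅ := Set.eq_empty_of_forall_notMem fun ξ hξ => hV hξ.1
      rw [this, measureReal_empty]; positivity
  calc _ ≤ _ := measureReal_mono hsub (measure_ne_top _ _)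
    _ ≤ _ := measureReal_biUnion_finset_le _ _
    _ ≤ _ := sum_le_card_nsmul _ _ _ hB
    _ ≤ _ := by
      rw [nsmul_eq_mul]
      refine mul_le_mul_of_nonneg_right ?_ (by positivity)
      exact_mod_cast card_filter_card_le N k

/-- The candidates are random as well, hence the union over all ordered pairs; the factor `2`
accounts for the two orders of the arguments of `C`. -/
theorem measureReal_not_comparesWell_le [LinearOrder N] (hm : Monotone f) (h0 : 0 ≤ f ∅)
    {g r : ℝ} (hg : 0 < g) (hr1 : r < 1)
    (hgap : ∀ t u : ℝ, 0 < t → 0 ≤ u → u ≤ r * t →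
      ∫ p, lossSign t u p ∂(D.prod D) ≤ -g) (l : ℕ) (C : Finset N → Finset N → Finset N) :
    (noiseLaw N D).real {ξ | ¬ ComparesWell (noisyOracle f ξ) f r k l C} ≤
      (Fintype.card N + 1) ^ k * (Fintype.card N + 1) ^ k *
        (2 * Real.exp (-(g ^ 2 * 2 ^ l / 2))) := by
  set B := fun T U A : Finset N => {ξ : Finset N → ℝ |
    (Disjoint A (T ∪ U) ∧ #A = l ∧ 0 < f T ∧ ∀ X ⊆ A, f (U ∪ X) ≤ r * f (T ∪ X)) ∧
    ¬ wins (noisyOracle f ξ) U T A < wins (noisyOracle f ξ) T U A}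
  set Q := univ.filter fun S : Finset N => #S ≤ k
  have hsub : {ξ | ¬ ComparesWell (noisyOracle f ξ) f r k l C} ⊆
      ⋃ p ∈ Q ×ˢ Q, (B p.1 p.2 (C p.1 p.2) ∪ B p.1 p.2 (C p.2 p.1)) := by
    intro ξ hξ
    simp only [Set.mem_ofPred_eq, ComparesWell, not_forall] at hξ
    obtain ⟨T, U, A, hA, hT, hU, h1, h2, h3, h4, h5⟩ := hξ
    refine Set.mem_biUnion (mem_coe.2 (mem_product (p := (T, U)).2
      ⟨mem_filter.2 ⟨mem_univ T, hT⟩, mem_filter.2 ⟨mem_univ U, hU⟩⟩)) ?_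
    rcases hA with rfl | rfl
    · exact Or.inl ⟨⟨h1, h2, h3, h4⟩, h5⟩
    · exact Or.inr ⟨⟨h1, h2, h3, h4⟩, h5⟩
  have hB : ∀ T U A, (noiseLaw N D).real (B T U A) ≤ Real.exp (-(g ^ 2 * 2 ^ l / 2)) := by
    intro T U A
    by_cases h : Disjoint A (T ∪ U) ∧ #A = l ∧ 0 < f T ∧ ∀ X ⊆ A, f (U ∪ X) ≤ r * f (T ∪ X)
    · obtain ⟨h1, rfl, h3, h4⟩ := h
      exact (measureReal_mono (fun ξ hξ => hξ.2) (measure_ne_top _ _)).trans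
        (measureReal_compare_wrong_le hm h0 hg hr1 hgap h1 h3 h4)
    · have : B T U A = ∅ := Set.eq_empty_of_forall_notMem fun ξ hξ => h hξ.1
      rw [this, measureReal_empty]; positivity
  have hB2 : ∀ p ∈ Q ×ˢ Q, (noiseLaw N D).real (B p.1 p.2 (C p.1 p.2) ∪ B p.1 p.2 (C p.2 p.1)) ≤
      2 * Real.exp (-(g ^ 2 * 2 ^ l / 2)) := fun p _ => by
    have := measureReal_union_le (μ := noiseLaw N D) (B p.1 p.2 (C p.1 p.2))
      (B p.1 p.2 (C p.2 p.1))
    linarith [hB p.1 p.2 (C p.1 p.2), hB p.1 p.2 (C p.2 p.1)]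
  calc _ ≤ _ := measureReal_mono hsub (measure_ne_top _ _)
    _ ≤ _ := measureReal_biUnion_finset_le _ _
    _ ≤ _ := sum_le_card_nsmul _ _ _ hB2
    _ ≤ _ := by
      rw [nsmul_eq_mul, card_product]
      push_cast
      have : (#Q : ℝ) ≤ (Fintype.card N + 1) ^ k := by exact_mod_cast card_filter_card_le N k
      exact mul_le_mul_of_nonneg_right (mul_le_mul this this (by positivity) (by positivity))
        (by positivity)

end UnionBound

/-! ### Numerical estimates for the failure probability -/

section Numerics

/-- The union bounds cost `exp (O(u ^ 2))`, as `k * log (n + 1) ≤ 2 * A * u ^ 2`. The noise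
exponents are at least `c * u ^ 23`: the exponent `25` loses two powers to `k ^ 2`. -/
theorem failure_bound {A c₁ c₂ u : ℝ} {m n k l : ℕ} (hA : 0 < A) (hc₁ : 0 < c₁) (hc₂ : 0 < c₂)
    (hk0 : 0 < k) (hu1 : 1 ≤ u) (hu : (4 * A + 2 * m + 4) / min (c₁ / A ^ 2) c₂ ≤ u)
    (hk : (k : ℝ) ≤ A * u) (hn0 : 0 < n) (hn : Real.log (n + 1) ≤ 2 * u)
    (hl : u ^ 25 ≤ (2 : ℝ) ^ l) :
    m * (((n : ℝ) + 1) ^ k * (2 * Real.exp (-(c₁ / k ^ 2 * 2 ^ l)))) +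
      ((n : ℝ) + 1) ^ k * ((n : ℝ) + 1) ^ k * (2 * Real.exp (-(c₂ * 2 ^ l))) ≤ 1 / n := by
  have hu0 : 0 < u := by linarith
  have hkR : (0 : ℝ) < k := by exact_mod_cast hk0
  have hnR : (0 : ℝ) < n := by exact_mod_cast hn0
  set c := min (c₁ / A ^ 2) c₂ with hc
  have hc0 : 0 < c := lt_min (by positivity) hc₂
  have hpow : ((n : ℝ) + 1) ^ k ≤ Real.exp (2 * A * u ^ 2) := by
    rw [← Real.exp_log (by positivity : (0 : ℝ) < (n : ℝ) + 1), ← Real.exp_nat_mul]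
    refine Real.exp_le_exp.2 ?_
    calc (k : ℝ) * Real.log (n + 1) ≤ A * u * (2 * u) :=
          mul_le_mul hk hn (Real.log_nonneg (by linarith)) (by positivity)
      _ = _ := by ring
  have hpow1 : 1 ≤ Real.exp (2 * A * u ^ 2) := Real.one_le_exp (by positivity)
  have h1 : c * u ^ 23 ≤ c₁ / k ^ 2 * 2 ^ l := by
    have e1 : c₁ / A ^ 2 * u ^ 23 = c₁ / (A * u) ^ 2 * u ^ 25 := by field_simp
    have e2 : c₁ / (A * u) ^ 2 ≤ c₁ / k ^ 2 :=
      div_le_div_of_nonneg_left hc₁.le (by positivity) (pow_le_pow_left₀ hkR.le hk 2)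
    calc c * u ^ 23 ≤ c₁ / A ^ 2 * u ^ 23 :=
          mul_le_mul_of_nonneg_right (min_le_left _ _) (by positivity)
      _ = c₁ / (A * u) ^ 2 * u ^ 25 := e1
      _ ≤ _ := mul_le_mul e2 hl (by positivity) (by positivity)
  have h2 : c * u ^ 23 ≤ c₂ * 2 ^ l := by
    have e1 : u ^ 23 ≤ u ^ 25 := pow_le_pow_right₀ hu1 (by norm_num)
    exact mul_le_mul (min_le_right _ _) (e1.trans hl) (by positivity) hc₂.le
  -- The term `4 * A` pays for `E * E` and `2 * m + 2` for the prefactor; the remaining `2` leaves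
  -- `exp (-2 u) ≤ 1 / n`.
  have h3 : (4 * A + 2 * m + 4) * u ^ 2 ≤ c * u ^ 23 := by
    rw [div_le_iff₀ hc0] at hu
    have e1 : u ^ 3 ≤ u ^ 23 := pow_le_pow_right₀ hu1 (by norm_num)
    calc (4 * A + 2 * m + 4) * u ^ 2 ≤ u * c * u ^ 2 :=
          mul_le_mul_of_nonneg_right hu (by positivity)
      _ = c * u ^ 3 := by ring
      _ ≤ _ := mul_le_mul_of_nonneg_left e1 hc0.le
  set E := Real.exp (2 * A * u ^ 2)
  set F := Real.exp (-(c * u ^ 23)) with hF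
  have t1 : ((n : ℝ) + 1) ^ k * (2 * Real.exp (-(c₁ / k ^ 2 * 2 ^ l))) ≤ E * E * (2 * F) := by
    refine mul_le_mul (hpow.trans (le_mul_of_one_le_left (by positivity) hpow1)) ?_
      (by positivity) (by positivity)
    exact mul_le_mul_of_nonneg_left (Real.exp_le_exp.2 (neg_le_neg h1)) (by norm_num)
  have t2 : ((n : ℝ) + 1) ^ k * ((n : ℝ) + 1) ^ k * (2 * Real.exp (-(c₂ * 2 ^ l))) ≤
      E * E * (2 * F) := by
    refine mul_le_mul (mul_le_mul hpow hpow (by positivity) (by positivity)) ?_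
      (by positivity) (by positivity)
    exact mul_le_mul_of_nonneg_left (Real.exp_le_exp.2 (neg_le_neg h2)) (by norm_num)
  have t3 : (2 * m + 2 : ℝ) ≤ Real.exp ((2 * m + 2) * u ^ 2) := by
    have e1 : (1 : ℝ) ≤ u ^ 2 := one_le_pow₀ hu1
    have e2 : (2 * m + 2 : ℝ) ≤ (2 * m + 2) * u ^ 2 := le_mul_of_one_le_right (by positivity) e1
    linarith [Real.add_one_le_exp ((2 * m + 2 : ℝ) * u ^ 2)]
  have t4 : (n : ℝ) ≤ Real.exp (2 * u) := by
    have := (Real.log_le_iff_le_exp (by positivity : (0 : ℝ) < (n : ℝ) + 1)).1 hn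
    linarith
  have t5 : Real.exp ((2 * m + 2) * u ^ 2) * (E * E * F) ≤ Real.exp (-(2 * u)) := by
    rw [hF, ← Real.exp_add, ← Real.exp_add, ← Real.exp_add]
    refine Real.exp_le_exp.2 ?_
    have e1 : u ≤ u ^ 2 := by nlinarith
    linarith
  calc _ ≤ m * (E * E * (2 * F)) + E * E * (2 * F) :=
        add_le_add (mul_le_mul_of_nonneg_left t1 (by positivity)) t2
    _ = (2 * m + 2) * (E * E * F) := by ring
    _ ≤ Real.exp ((2 * m + 2) * u ^ 2) * (E * E * F) :=
        mul_le_mul_of_nonneg_right t3 (by positivity)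
    _ ≤ Real.exp (-(2 * u)) := t5
    _ ≤ 1 / n := by
      rw [Real.exp_neg, ← one_div]
      exact one_div_le_one_div_of_le hnR t4

/-- The constant `92` leaves room for rounding up: `2400 / 92 > 26` and `3168 / 92 > 34`, against
`25` and `33`, where `log n ≥ 2` and `log log n ≥ 1`. -/
theorem smoothingSize_le {ε : ℝ} (hε : 0 < ε) {n k : ℕ} (hn : 2 ≤ Real.logb 2 n)
    (hk : 3168 * Real.logb 2 (Real.logb 2 n) / ε ^ 2 ≤ k) :
    (smoothingSize ε n k : ℝ) ≤ ε ^ 2 / 92 * k := by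
  have hL : 1 ≤ Real.logb 2 (Real.logb 2 n) := by
    rw [Real.le_logb_iff_rpow_le (by norm_num) (by linarith)]; simpa using hn
  have hkε : (0 : ℝ) ≤ k * ε ^ 2 := by positivity
  rw [smoothingSize]
  split_ifs with h
  · have h1 := Nat.ceil_lt_add_one (by linarith : 0 ≤ 25 * Real.logb 2 n)
    rw [div_le_iff₀ (by positivity)] at h
    linarith
  · have h1 := Nat.ceil_lt_add_one (by linarith : 0 ≤ 33 * Real.logb 2 (Real.logb 2 n))
    rw [div_le_iff₀ (by positivity)] at hk
    linarith

theorem two_pow_ceil_ge {x : ℝ} (hx : 0 < x) (a : ℕ) :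
    x ^ a ≤ (2 : ℝ) ^ ⌈a * Real.logb 2 x⌉₊ := by
  have h1 : x ^ a = (2 : ℝ) ^ (a * Real.logb 2 x : ℝ) := by
    rw [mul_comm, Real.rpow_mul (by norm_num),
      Real.rpow_logb (by norm_num) (by norm_num) hx, Real.rpow_natCast]
  rw [h1, ← Real.rpow_natCast]
  exact Real.rpow_le_rpow_of_exponent_le (by norm_num) (Nat.le_ceil _)

theorem logb_two_le_self (n : ℕ) : Real.logb 2 n ≤ n := by
  rcases Nat.eq_zero_or_pos n with rfl | hn
  · simp
  rw [Real.logb_le_iff_le_rpow (by norm_num) (by exact_mod_cast hn), Real.rpow_natCast]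
  exact_mod_cast n.lt_two_pow_self.le

/-- In both regimes there is a scale `u` in which `k` is at most linear and the number of smoothing
sets is a high power. -/
theorem exists_scale {ε : ℝ} (hε : 0 < ε) (hε1 : ε ≤ 1) {n k : ℕ} (hn : 2 ≤ Real.logb 2 n)
    (hkn : k < n) :
    ∃ u : ℝ, Real.logb 2 n ≤ u ∧ (k : ℝ) ≤ 2400 / ε ^ 2 * u ∧ Real.log (n + 1) ≤ 2 * u ∧
      u ^ 25 ≤ (2 : ℝ) ^ smoothingSize ε n k := by
  have hn1 : (1 : ℝ) ≤ n := by exact_mod_cast (by omega : 1 ≤ n)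
  rw [smoothingSize]
  split_ifs with h
  -- For a large budget the scale is `n` itself, since `2 ^ ℓ ≥ n ^ 25`.
  · refine ⟨n, logb_two_le_self n, ?_, ?_, by
      exact_mod_cast two_pow_ceil_ge (x := n) (by linarith) 25⟩
    · have h1 : 1 ≤ 2400 / ε ^ 2 := by
        rw [one_le_div (by positivity)]; nlinarith
      have h2 : (k : ℝ) ≤ n := by exact_mod_cast hkn.le
      nlinarith
    · have := Real.log_le_sub_one_of_pos (by linarith : (0 : ℝ) < n + 1)
      linarith
  -- Otherwise the scale is `log n`, and the failed case condition bounds `k`.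
  · refine ⟨Real.logb 2 n, le_rfl, ?_, ?_, ?_⟩
    · rw [div_mul_eq_mul_div]; exact (not_le.1 h).le
    · have hlog0 : 0 ≤ Real.log n := Real.log_nonneg hn1
      have h1 : Real.log n ≤ Real.logb 2 n := by
        rw [Real.logb, le_div_iff₀ (Real.log_pos (by norm_num))]
        have := Real.log_two_lt_d9
        nlinarith
      have h2 : Real.log (n + 1) ≤ Real.log (n * 2) := Real.log_le_log (by linarith) (by linarith)
      rw [Real.log_mul (by linarith) (by norm_num)] at h2
      have := Real.log_two_lt_d9
      linarith
    · refine (pow_le_pow_right₀ (by linarith) (by norm_num : 25 ≤ 33)).trans ?_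
      exact_mod_cast two_pow_ceil_ge (x := Real.logb 2 n) (by linarith) 33

end Numerics

/-! ### Assembly of the probabilistic guarantee -/

/-- The noise is reliable with high probability, uniformly in the instance. -/
theorem exists_measureReal_guarantee {ε : ℝ} (hε : 0 < ε) (hε1 : ε ≤ 1) (D : Measure ℝ)
    [IsProbabilityMeasure D] (hD : HasGeneralizedExponentialTail D) (hD' : IsMultiplierLaw D) :
    ∃ u₀ : ℝ, 2 ≤ u₀ ∧ ∀ n k l m : ℕ, u₀ ≤ Real.logb 2 n →
      3168 * Real.logb 2 (Real.logb 2 n) / ε ^ 2 ≤ k → k < n →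
      l = smoothingSize ε n k → m = numSets ε → m * l ≤ k →
      ∀ f : Finset (Fin n) → ℝ, Monotone f → IsSubmodular f → 0 ≤ f ∅ → 0 < optValue f k →
      ∀ H : Fin m → Finset (Fin n), (∀ i, #(H i) = l) →
        (∀ i j, i ≠ j → Disjoint (H i) (H j)) →
      ∀ C : Finset (Fin n) → Finset (Fin n) → Finset (Fin n),
        (∀ T U, l ≤ #(T ∪ U)ᶜ → Disjoint (C T U) (T ∪ U) ∧ #(C T U) = l) →
      1 - 1 / (n : ℝ) ≤ (noiseLaw (Fin n) D).real
        {ξ | HasComparisonRoom (noisyOracle f ξ) k l H →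
          (1 - 1 / Real.exp 1 - ε) * optValue f k ≤ f (slickGreedy (noisyOracle f ξ) k H C)} := by
  obtain ⟨s, hs, hint⟩ := exists_integrable_exp_mul_abs hD hD'
  set μ := ∫ x, x ∂D with hμdef
  have hμ : 0 < μ := integral_pos_of_isMultiplierLaw (integrable_id_of_exp hs hint) hD'
  obtain ⟨K₀, hK₀, r, hr, hmgf₀⟩ := exists_mgf_sub_bound hs hint μ hμdef
  -- Enlarging the constant brings every deviation `μ * η ≤ μ` into the Chernoff range.
  set K := K₀ + μ / (2 * r) with hKdef
  have hK : 0 < K := by positivity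
  have hKr : μ ≤ 2 * K * r := by
    have e : 2 * K * r = 2 * K₀ * r + μ := by rw [hKdef]; field_simp
    rw [e]; linarith [mul_pos hK₀ hr]
  have hmgf : ∀ t : ℝ, |t| ≤ r → Integrable (fun x => Real.exp (t * (x - μ))) D ∧
      ∫ x, Real.exp (t * (x - μ)) ∂D ≤ Real.exp (K * t ^ 2) := fun t ht => by
    obtain ⟨h1, h2⟩ := hmgf₀ t ht
    refine ⟨h1, h2.trans (Real.exp_le_exp.2 (mul_le_mul_of_nonneg_right ?_ (sq_nonneg t)))⟩
    rw [hKdef]; exact le_add_of_nonneg_right (by positivity)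
  have hρ0 : 0 < 1 - ε ^ 2 / 80 / 2 := by nlinarith
  have hρ1 : 1 - ε ^ 2 / 80 / 2 < 1 := by have := sq_pos_of_pos hε; linarith
  obtain ⟨g, hg, hgap⟩ := exists_gap hD' hρ0 hρ1
  -- The tolerance `η = ε / (100 k)` splits off its `k`, which yields the exponent `c₁ / k ^ 2 * 2 ^
  -- l`.
  set c₁ := (μ * (ε / 100)) ^ 2 / (4 * K) with hc₁
  set c₂ := g ^ 2 / 2 with hc₂
  set A := 2400 / ε ^ 2 with hA
  refine ⟨max 2 ((4 * A + 2 * (numSets ε : ℕ) + 4) / min (c₁ / A ^ 2) c₂), le_max_left _ _, ?_⟩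
  intro n k l m hn hk hkn hl hm hml f hmono hsub h0 hW H hcard hdisj C hC
  obtain ⟨hn2, hnu⟩ := max_le_iff.1 hn
  obtain ⟨u, hu, hku, hlog, hpow⟩ := exists_scale hε hε1 hn2 hkn
  have hL : 1 ≤ Real.logb 2 (Real.logb 2 n) := by
    rw [Real.le_logb_iff_rpow_le (by norm_num) (by linarith)]; simpa using hn2
  have hkR : (0 : ℝ) < k := lt_of_lt_of_le (by positivity) hk
  have hk0 : 0 < k := by exact_mod_cast hkR
  have hlk := smoothingSize_le hε hn2 hk
  rw [← hl] at hlk hpow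
  rw [← hm] at hnu
  set P := noiseLaw (Fin n) D
  set η := ε / (100 * k) with hη
  have hη1 : η ≤ 1 := by
    have : (1 : ℝ) ≤ k := by exact_mod_cast hk0
    rw [hη, div_le_one (by positivity)]; linarith
  have hη0 : 0 ≤ η := by positivity
  set good := {ξ : Finset (Fin n) → ℝ | HasComparisonRoom (noisyOracle f ξ) k l H →
    (1 - 1 / Real.exp 1 - ε) * optValue f k ≤ f (slickGreedy (noisyOracle f ξ) k H C)}
  set bad₁ := ⋃ j ∈ (univ : Finset (Fin m)),
    {ξ | ¬ SmoothClose (noisyOracle f ξ) f μ (η * optValue f k) k (H j)}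
  set bad₂ := {ξ | ¬ ComparesWell (noisyOracle f ξ) f (1 - ε ^ 2 / 80 / 2) k l C}
  have hcover : Set.univ ⊆ good ∪ (bad₁ ∪ bad₂) := by
    intro ξ _
    by_cases h1 : ξ ∈ bad₁
    · exact Or.inr (Or.inl h1)
    by_cases h2 : ξ ∈ bad₂
    · exact Or.inr (Or.inr h2)
    refine Or.inl fun hroom => ?_
    have hclose : ∀ j, SmoothClose (noisyOracle f ξ) f μ (η * optValue f k) k (H j) := by
      intro j
      by_contra h
      exact h1 (Set.mem_biUnion (mem_coe.2 (mem_univ j)) h)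
    exact slickGreedy_guarantee hε hε1 hm hsub hmono h0 hμ hW hk0 hlk hcard hdisj hml hclose hC
      (not_not.1 h2) hroom
  have hbad₁ : P.real bad₁ ≤ m * (((n : ℝ) + 1) ^ k * (2 * Real.exp (-(c₁ / k ^ 2 * 2 ^ l)))) := by
    have hone : ∀ j ∈ (univ : Finset (Fin m)),
        P.real {ξ | ¬ SmoothClose (noisyOracle f ξ) f μ (η * optValue f k) k (H j)} ≤
        ((n : ℝ) + 1) ^ k * (2 * Real.exp (-(c₁ / k ^ 2 * 2 ^ l))) := by
      intro j _
      have := measureReal_not_smoothClose_le (D := D) hmono h0 hK hmgf hW (η := η) (by positivity)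
        ((mul_le_of_le_one_right hμ.le hη1).trans hKr) (H j)
      rw [Fintype.card_fin, hcard] at this
      have e : (μ * η) ^ 2 * 2 ^ l / (4 * K) = c₁ / k ^ 2 * 2 ^ l := by
        rw [hc₁, hη]; field_simp
      rwa [e] at this
    refine (measureReal_biUnion_finset_le _ _).trans ((sum_le_card_nsmul _ _ _ hone).trans ?_)
    rw [nsmul_eq_mul, card_univ, Fintype.card_fin]
  have hbad₂ : P.real bad₂ ≤
      ((n : ℝ) + 1) ^ k * ((n : ℝ) + 1) ^ k * (2 * Real.exp (-(c₂ * 2 ^ l))) := by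
    have := measureReal_not_comparesWell_le (D := D) (k := k) hmono h0 hg hρ1 hgap l C
    rw [Fintype.card_fin] at this
    have e : g ^ 2 * 2 ^ l / 2 = c₂ * 2 ^ l := by rw [hc₂]; ring
    rwa [e] at this
  have hfail := failure_bound (m := m) (l := l) (by positivity : 0 < A) (by positivity : 0 < c₁)
    (by positivity : 0 < c₂) hk0 (by linarith : 1 ≤ u) (hnu.trans hu) hku (by omega) hlog hpow
  have h1 : (1 : ℝ) ≤ P.real (good ∪ (bad₁ ∪ bad₂)) := by
    rw [Set.univ_subset_iff.1 hcover, probReal_univ]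
  have h2 := measureReal_union_le (μ := P) good (bad₁ ∪ bad₂)
  have h3 := measureReal_union_le (μ := P) bad₁ bad₂
  linarith

theorem mul_optValue_le_of_nonpos {N : Type*} [Fintype N] {f : Finset N → ℝ}
    {k : ℕ} (hm : Monotone f) (h0 : 0 ≤ f ∅) (hW : optValue f k ≤ 0) (c : ℝ) (T : Finset N) :
    c * optValue f k ≤ f T := by
  have h1 : 0 ≤ optValue f k := h0.trans (le_optValue f (by simp))
  rw [le_antisymm hW h1, mul_zero]
  exact h0.trans (hm (empty_subset T))

end NoisySubmodular

theorem mainTheorem1 (ε : ℝ) (hε : 0 < ε) (hε1 : ε ≤ 1)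
    (D : Measure ℝ) [IsProbabilityMeasure D]
    (hD : NoisySubmodular.HasGeneralizedExponentialTail D)
    (hD' : NoisySubmodular.IsMultiplierLaw D) :
    ∃ n₀ : ℕ, ∀ n k l m : ℕ, n₀ ≤ n →
      3168 * Real.logb 2 (Real.logb 2 n) / ε ^ 2 ≤ k →
      l = NoisySubmodular.smoothingSize ε n k →
      m = NoisySubmodular.numSets ε →
      ∀ f : Finset (Fin n) → ℝ, Monotone f → NoisySubmodular.IsSubmodular f → 0 ≤ f ∅ →
      ∀ H : Fin m → Finset (Fin n), (∀ i, (H i).card = l) →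
        (∀ i j, i ≠ j → Disjoint (H i) (H j)) →
      ∀ C : Finset (Fin n) → Finset (Fin n) → Finset (Fin n),
        (∀ T U, l ≤ (T ∪ U)ᶜ.card → Disjoint (C T U) (T ∪ U) ∧ (C T U).card = l) →
      1 - 1 / (n : ℝ) ≤
        (NoisySubmodular.noiseLaw (Fin n) D).real
          {ξ | NoisySubmodular.HasComparisonRoom (NoisySubmodular.noisyOracle f ξ) k l H →
            (NoisySubmodular.slickGreedy (NoisySubmodular.noisyOracle f ξ) k H C).card ≤ k ∧
            (1 - 1 / Real.exp 1 - ε) * NoisySubmodular.optValue f k ≤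
              f (NoisySubmodular.slickGreedy (NoisySubmodular.noisyOracle f ξ) k H C)} ∧
      (2 * k ≤ n → ∀ ξ : Finset (Fin n) → ℝ,
        NoisySubmodular.HasComparisonRoom (NoisySubmodular.noisyOracle f ξ) k l H) := by
  open NoisySubmodular in
  obtain ⟨u₀, hu₀, hmain⟩ := exists_measureReal_guarantee hε hε1 D hD hD'
  refine ⟨⌈(2 : ℝ) ^ u₀⌉₊, fun n k l m hn hk hl hm f hmono hsub h0 H hcard hdisj C hC => ?_⟩
  have hnR : (2 : ℝ) ^ u₀ ≤ n := Nat.ceil_le.1 hn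
  have hn0 : (0 : ℝ) < n := lt_of_lt_of_le (by positivity) hnR
  have hlogn : u₀ ≤ Real.logb 2 n := (Real.le_logb_iff_rpow_le (by norm_num) hn0).2 hnR
  have hlk := smoothingSize_le hε (hu₀.trans hlogn) hk
  rw [← hl] at hlk
  have hb := numSets_bounds hε hε1
  rw [← hm] at hb
  have hm0 : 0 < m := by
    rcases Nat.eq_zero_or_pos m with h | h
    · rw [h] at hb; norm_num at hb
    · exact h
  have hml : m * l ≤ k := by
    have : (m : ℝ) * l ≤ k := by
      calc (m : ℝ) * l ≤ m * (ε ^ 2 / 92 * k) := mul_le_mul_of_nonneg_left hlk (by positivity)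
        _ = (ε * m) * (ε / 92 * k) := by ring
        _ ≤ 7 * (ε / 92 * k) := mul_le_mul_of_nonneg_right hb.2 (by positivity)
        _ = ε * (7 / 92 * k) := by ring
        _ ≤ 1 * (7 / 92 * k) := mul_le_mul_of_nonneg_right hε1 (by positivity)
        _ ≤ k := by have : (0 : ℝ) ≤ k := by positivity
                    linarith
    exact_mod_cast this
  have hcardle : ∀ ξ, #(slickGreedy (noisyOracle f ξ) k H C) ≤ k := fun ξ => by
    obtain ⟨j, hj⟩ := slickGreedy_eq_candidate (noisyOracle f ξ) k H C hm0
    rw [hj]; exact card_candidate_le _ hcard hdisj hml j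
  refine ⟨?_, fun h2k ξ => hasComparisonRoom _ hcard hdisj hml hm0 (by simpa using h2k)⟩
  -- In the degenerate cases (optimum zero, or `k ≥ n`, where every candidate is the whole ground
  -- set) the value bound holds for every noise.
  have htriv : (∀ ξ, (1 - 1 / Real.exp 1 - ε) * optValue f k ≤
      f (slickGreedy (noisyOracle f ξ) k H C)) → 1 - 1 / (n : ℝ) ≤ (noiseLaw (Fin n) D).real
        {ξ | HasComparisonRoom (noisyOracle f ξ) k l H →
          #(slickGreedy (noisyOracle f ξ) k H C) ≤ k ∧ (1 - 1 / Real.exp 1 - ε) * optValue f k ≤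
            f (slickGreedy (noisyOracle f ξ) k H C)} := fun h => by
    have h1 : 0 < 1 / (n : ℝ) := by positivity
    refine le_trans ?_ (measureReal_mono (s₁ := Set.univ) fun ξ _ _ => ⟨hcardle ξ, h ξ⟩)
    rw [probReal_univ]
    linarith
  rcases le_or_gt (optValue f k) 0 with hW | hW
  · exact htriv fun ξ => mul_optValue_le_of_nonpos hmono h0 hW _ _
  rcases le_or_gt n k with hnk | hkn
  · refine htriv fun ξ => ?_
    obtain ⟨j, hj⟩ := slickGreedy_eq_candidate (noisyOracle f ξ) k H C hm0
    rw [hj, candidate_eq_univ _ hcard hdisj hml (by simpa using hnk) j]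
    obtain ⟨O, -, hO⟩ := exists_eq_optValue f k
    have h1 : optValue f k ≤ f univ := hO ▸ hmono (subset_univ O)
    have h2 : 0 < 1 / Real.exp 1 := by positivity
    refine (mul_le_of_le_one_left hW.le ?_).trans h1
    linarith
  · refine (hmain n k l m hlogn hk hkn hl hm hml f hmono hsub h0 hW H hcard hdisj C hC).trans ?_
    exact measureReal_mono fun ξ hξ hroom => ⟨hcardle ξ, hξ hroom⟩
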